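/- Let $M$ be a finite-dimensional smooth manifold and let $\mathcal{G}$ be a finite-dimensional Lie group with Lie algebra $\mathfrak{g}$, whose commutator is denoted $\{\cdot,\cdot\}$. An infinitesimal stochastic transformation of $M$ is a triple $V=(Y,C,\tau)$ of a smooth vector field $Y$ on $M$ and smooth maps $C:M\to\mathfrak{g}$, $\tau:M\to\mathbb{R}$; it is called strong if $C=0$ and $\tau=0$. The space $\mathcal{V}(M)$ of these triples carries the Lie bracket $$[V_1,V_2]=\big([Y_1,Y_2],\;Y_1(C_2)-Y_2(C_1)-\{C_1,C_2\},\;Y_1(\tau_2)-Y_2(\tau_1)\big).$$ A stochastic transformation $T\in S(M,M')$ is a triple $T=(\Phi,B,\eta)$ of a diffeomorphism $\Phi:M\to M'$, a smooth map $B:M\to\mathcal{G}$ and a smooth positive function $\eta:M\to(0,\infty)$; one writes $S(U)=S(U,U)$. The push-forward of $V=(Y,C,\tau)$ by $T$ is $$T_*(V)=\big(\Phi_*(Y),\;(\mathrm{Ad}_{B}(C)+R_{B^{-1}*}(Y(B)))\circ\Phi^{-1},\;(\tau+Y(\eta)\,\eta^{-1})\circ\Phi^{-1}\big),$$ where $Y(B)$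 is the image of $Y$ under the differential of $B$, and $L_{g*}$, $R_{g*}$ are the differentials of left and right multiplication by $g\in\mathcal{G}$. **Theorem.** Let $V_i=(Y_i,C_i,\tau_i)\in\mathcal{V}(M)$, $i=1,\dots,r$, be such that $K=\mathrm{span}_{\mathbb{R}}\{V_1,\dots,V_r\}$ is closed under the bracket of $\mathcal{V}(M)$ (that is, a Lie algebra), and suppose that $Y_1(x),\dots,Y_r(x)$ are linearly independent for every $x\in M$. Then for every $x_0\in M$ there exist an open neighbourhood $U$ of $x_0$ and a stochastic transformation $T\in S(U)$ of the form $T=(\mathrm{Id}_U,B,\eta)$ such that, for every $i=1,\dots,r$, the push-forward $T_*(V_i|_U)\in\mathcal{V}(U)$ is the strong infinitesimal stochastic transformation $(Y_i|_U,0,0)$. Furthermore, $B$ and $\eta$ satisfy on $U$, for every $i=1,\dots,r$, $$Y_i(B)=-L_{B*}(C_i),\qquad Y_i(\eta)=-\tau_i\,\eta .$$ -/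

import Mathlib

open scoped Manifold ContDiff

noncomputable section

namespace StochSym

/-- A triple `(Y, C, τ)` consisting of a (not necessarily smooth) vector field `Y` on the manifold
`M`, a map `C` from `M` to the Lie algebra of the Lie group `G`, and a function `τ : M → ℝ`.
It is a real vector space under the pointwise operations. `E` and `F` are the model spaces
of `M` and `G`. -/
abbrev Triple (E : Type*) [NormedAddCommGroup E] [NormedSpace ℝ E]
    (M : Type*) [TopologicalSpace M] [ChartedSpace E M]
    (F : Type*) [NormedAddCommGroup F] [NormedSpace ℝ F]
    (G : Type*) [TopologicalSpace G] [ChartedSpace F G] [Group G] : Type _ :=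
  ((x : M) → TangentSpace 𝓘(ℝ, E) x) × (M → GroupLieAlgebra 𝓘(ℝ, F) G) × (M → ℝ)

section

variable {E : Type*} [NormedAddCommGroup E] [NormedSpace ℝ E]
  {M : Type*} [TopologicalSpace M] [ChartedSpace E M]
  {E' : Type*} [NormedAddCommGroup E'] [NormedSpace ℝ E']
  {M' : Type*} [TopologicalSpace M'] [ChartedSpace E' M']
  {F : Type*} [NormedAddCommGroup F] [NormedSpace ℝ F]
  {G : Type*} [TopologicalSpace G] [ChartedSpace F G] [Group G]

/-- The vector field `Y` of a triple `(Y, C, τ)`. -/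
def Triple.Y (V : Triple E M F G) : (x : M) → TangentSpace 𝓘(ℝ, E) x := V.1

/-- The Lie algebra valued map `C` of a triple `(Y, C, τ)`. -/
def Triple.C (V : Triple E M F G) : M → GroupLieAlgebra 𝓘(ℝ, F) G := V.2.1

/-- The function `τ` of a triple `(Y, C, τ)`. -/
def Triple.τ (V : Triple E M F G) : M → ℝ := V.2.2

/-- The derivative `Y(f)` of a vector-valued function `f` along a vector field `Y`. -/
def derivAlong {W : Type*} [NormedAddCommGroup W] [NormedSpace ℝ W]
    (Y : (x : M) → TangentSpace 𝓘(ℝ, E) x) (f : M → W) (x : M) : W :=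
  mfderiv 𝓘(ℝ, E) 𝓘(ℝ, W) f x (Y x)

/-- The push-forward `Y(B)` of a vector field `Y` with respect to a map `B : M → G`:
at `x` it is the tangent vector `dB_x (Y x)` at `B x`. -/
def pushAlong (Y : (x : M) → TangentSpace 𝓘(ℝ, E) x) (B : M → G) (x : M) :
    TangentSpace 𝓘(ℝ, F) (B x) :=
  mfderiv 𝓘(ℝ, E) 𝓘(ℝ, F) B x (Y x)

/-- The map `L_{g*} : 𝔤 → T_g G`, differential at the identity of the left translation by `g`. -/
def leftPush (g : G) (v : GroupLieAlgebra 𝓘(ℝ, F) G) : TangentSpace 𝓘(ℝ, F) g :=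
  mfderiv 𝓘(ℝ, F) 𝓘(ℝ, F) (fun h : G => g * h) 1 v

/-- The map `R_{g⁻¹*} : T_g G → 𝔤`, differential at `g` of the right translation by `g⁻¹`. -/
def rightPushInv (g : G) (v : TangentSpace 𝓘(ℝ, F) g) : GroupLieAlgebra 𝓘(ℝ, F) G :=
  mfderiv 𝓘(ℝ, F) 𝓘(ℝ, F) (fun h : G => h * g⁻¹) g v

/-- The adjoint action `Ad_g : 𝔤 → 𝔤`, differential at the identity of `h ↦ g h g⁻¹`. -/
def Ad (g : G) (v : GroupLieAlgebra 𝓘(ℝ, F) G) : GroupLieAlgebra 𝓘(ℝ, F) G :=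
  mfderiv 𝓘(ℝ, F) 𝓘(ℝ, F) (fun h : G => g * h * g⁻¹) 1 v

/-- A map into the Lie algebra of `G`, seen as a map into the normed space `F`, which is the
underlying topological vector space of the Lie algebra. -/
def toModel (C : M → GroupLieAlgebra 𝓘(ℝ, F) G) : M → F := C

/-- The derivative `Y(C)` of a Lie algebra valued function `C` along a vector field `Y`. -/
def derivAlongLie (Y : (x : M) → TangentSpace 𝓘(ℝ, E) x) (C : M → GroupLieAlgebra 𝓘(ℝ, F) G) :
    M → GroupLieAlgebra 𝓘(ℝ, F) G :=
  fun x => derivAlong (W := F) Y (toModel C) x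

/-- A triple is an infinitesimal stochastic transformation, `V ∈ 𝒱(M)`, if `Y` (as a section of
the tangent bundle), `C` and `τ` are smooth. -/
structure IsInfinitesimal [IsManifold 𝓘(ℝ, E) ∞ M] (V : Triple E M F G) : Prop where
  smooth_Y : ContMDiff 𝓘(ℝ, E) 𝓘(ℝ, E).tangent ∞
    (fun x => (⟨x, V.Y x⟩ : TangentBundle 𝓘(ℝ, E) M))
  smooth_C : ContMDiff 𝓘(ℝ, E) 𝓘(ℝ, F) ∞ (toModel V.C)
  smooth_τ : ContMDiff 𝓘(ℝ, E) 𝓘(ℝ, ℝ) ∞ V.τ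

/-- A strong triple, i.e. one of the form `(Y, 0, 0)`. -/
def IsStrong (V : Triple E M F G) : Prop := V.C = 0 ∧ V.τ = 0

/-- The Lie bracket
`[V₁, V₂] = ([Y₁, Y₂], Y₁(C₂) - Y₂(C₁) - {C₁, C₂}, Y₁(τ₂) - Y₂(τ₁))`, where `[Y₁, Y₂]` is the Lie
bracket of vector fields and `{·, ·}` that of the Lie algebra of `G`. -/
def bracket (V₁ V₂ : Triple E M F G) : Triple E M F G :=
  (VectorField.mlieBracket 𝓘(ℝ, E) V₁.Y V₂.Y,
    fun x => derivAlongLie V₁.Y V₂.C x - derivAlongLie V₂.Y V₁.C x - ⁅V₁.C x, V₂.C x⁆,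
    fun x => derivAlong V₁.Y V₂.τ x - derivAlong V₂.Y V₁.τ x)

/-- The linear space `K` is a Lie algebra of infinitesimal stochastic transformations, i.e. a Lie
subalgebra of `𝒱(M)`. -/
structure IsLieAlgebra [IsManifold 𝓘(ℝ, E) ∞ M] (K : Submodule ℝ (Triple E M F G)) : Prop where
  infinitesimal : ∀ V ∈ K, IsInfinitesimal V
  bracket_mem : ∀ V₁ ∈ K, ∀ V₂ ∈ K, bracket V₁ V₂ ∈ K

/-- The vector fields `Y₁, …, Y_r` are regular: linearly independent at every point. -/
def IsRegular {r : ℕ} (Y : Fin r → (x : M) → TangentSpace 𝓘(ℝ, E) x) : Prop :=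
  ∀ x : M, LinearIndependent ℝ (fun i => Y i x)

/-- The restriction of a triple on `M` to an open subset `U`. The vector field is pulled back along
the inclusion, an open embedding with invertible differential. -/
def Triple.restrict (V : Triple E M F G) (U : TopologicalSpace.Opens M) : Triple E U F G :=
  (VectorField.mpullback 𝓘(ℝ, E) 𝓘(ℝ, E) (Subtype.val : U → M) V.Y,
    fun x => V.C x, fun x => V.τ x)

end

/-- A stochastic transformation `(Φ, B, η) ∈ S(M, M')`. -/
structure StochTransf (E : Type*) [NormedAddCommGroup E] [NormedSpace ℝ E]
    (M : Type*) [TopologicalSpace M] [ChartedSpace E M]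
    (E' : Type*) [NormedAddCommGroup E'] [NormedSpace ℝ E']
    (M' : Type*) [TopologicalSpace M'] [ChartedSpace E' M']
    (F : Type*) [NormedAddCommGroup F] [NormedSpace ℝ F]
    (G : Type*) [TopologicalSpace G] [ChartedSpace F G] where
  Φ : M ≃ₘ^∞⟮𝓘(ℝ, E), 𝓘(ℝ, E')⟯ M'
  B : M → G
  η : M → ℝ
  smooth_B : ContMDiff 𝓘(ℝ, E) 𝓘(ℝ, F) ∞ B
  smooth_η : ContMDiff 𝓘(ℝ, E) 𝓘(ℝ, ℝ) ∞ η
  η_pos : ∀ x, 0 < η x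

section

variable {E : Type*} [NormedAddCommGroup E] [NormedSpace ℝ E]
  {M : Type*} [TopologicalSpace M] [ChartedSpace E M]
  {E' : Type*} [NormedAddCommGroup E'] [NormedSpace ℝ E']
  {M' : Type*} [TopologicalSpace M'] [ChartedSpace E' M']
  {F : Type*} [NormedAddCommGroup F] [NormedSpace ℝ F]
  {G : Type*} [TopologicalSpace G] [ChartedSpace F G] [Group G]

/-- The push-forward
`T_*(V) = (Φ_*(Y), (Ad_B(C) + R_{B⁻¹*}(Y(B))) ∘ Φ⁻¹, (τ + Y(η) η⁻¹) ∘ Φ⁻¹)`,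
where `Φ_*(Y)` is the vector field `y ↦ dΦ (Y (Φ⁻¹ y))`. -/
def StochTransf.pushforward (T : StochTransf E M E' M' F G) (V : Triple E M F G) :
    Triple E' M' F G :=
  (fun y => mfderiv 𝓘(ℝ, E) 𝓘(ℝ, E') T.Φ (T.Φ.symm y) (V.Y (T.Φ.symm y)),
    (fun x => Ad (T.B x) (V.C x) + rightPushInv (T.B x) (pushAlong V.Y T.B x)) ∘ T.Φ.symm,
    (fun x => V.τ x + derivAlong V.Y T.η x * (T.η x)⁻¹) ∘ T.Φ.symm)

end

end StochSym

end

/-! Both gauge equations ask for a graph tangent to lifted vector fields. On M × G put Z_i = (Y_i,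
-C_i^L), where v^L is the left invariant field of v; then Y_i(B) = -L_{B*}(C_i) says that the graph
of B is tangent to every Z_i. Since [v^L, w^L] = {v, w}^L, closure of K under the bracket gives
[Z_i, Z_j] = ∑ c_ijk Z_k with constant coefficients (`exists_structure_constants`,
`exists_parallel`). The Z_i project to the independent fields Y_i, so a Frobenius argument
(`exists_tangent_graph`) produces the graph near any point. The equation for log η is the same
problem for the additive group ℝ.

The Frobenius step flows ∑ a_i Z_i for unit time from a transversal. The derivative in a of the end
point stays in the span of the Z_k (`variation_mem_span`), and a dimension count shows that it fills
the span. Smooth dependence on a and on the initial point comes from the inverse function theorem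
applied to the Picard operator on curves (`exists_smooth_integralCurves`).

Finally Ad_B(C) = R_{B⁻¹*}(L_{B*}(C)), so the two equations make the pushed-forward C and τ vanish.
-/

namespace StochSym

open Set Filter Topology unitInterval

/-! ### Integration as an operator on continuous curves -/

section Volterra

variable {X : Type*} [NormedAddCommGroup X] [NormedSpace ℝ X]

/-- The integration operator on continuous curves: `volterra f t = ∫ s in 0..t, f s`. -/
noncomputable def volterra [CompleteSpace X] : C(I, X) →L[ℝ] C(I, X) :=
  LinearMap.mkContinuous
    { toFun := fun f =>
        ⟨fun t => ∫ s in (0 : ℝ)..t, f (projIcc 0 1 zero_le_one s),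
          (intervalIntegral.continuous_primitive (fun _ _ =>
            (f.continuous.comp continuous_projIcc).intervalIntegrable _ _) 0).comp
              continuous_subtype_val⟩
      map_add' := fun f g => by
        ext t
        exact intervalIntegral.integral_add
          ((f.continuous.comp continuous_projIcc).intervalIntegrable _ _)
          ((g.continuous.comp continuous_projIcc).intervalIntegrable _ _)
      map_smul' := fun c f => by
        ext t
        exact intervalIntegral.integral_smul c _ } 1 (fun f => by
    refine (ContinuousMap.norm_le _ (by positivity)).2 fun t => ?_
    refine (intervalIntegral.norm_integral_le_of_norm_le_const
      (fun s _ => f.norm_coe_le_norm _)).trans ?_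
    have h : |(t : ℝ) - 0| ≤ 1 := by
      rw [sub_zero, abs_of_nonneg t.2.1]
      exact t.2.2
    nlinarith [norm_nonneg f])

variable [CompleteSpace X]

lemma volterra_apply (f : C(I, X)) (t : I) :
    volterra f t = ∫ s in (0 : ℝ)..t, f (projIcc 0 1 zero_le_one s) := rfl

lemma volterra_const_one (v : X) : volterra (ContinuousMap.const I v) 1 = v := by
  simp [volterra_apply]

lemma hasDerivAt_integral_projIcc (f : C(I, X)) (t : ℝ) :
    HasDerivAt (fun t => ∫ s in (0 : ℝ)..t, f (projIcc 0 1 zero_le_one s))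
      (f (projIcc 0 1 zero_le_one t)) t := by
  have h : Continuous fun s : ℝ => f (projIcc 0 1 zero_le_one s) :=
    f.continuous.comp continuous_projIcc
  exact intervalIntegral.integral_hasDerivAt_right (h.intervalIntegrable _ _)
    h.stronglyMeasurable.stronglyMeasurableAtFilter h.continuousAt

end Volterra

/-! ### Smoothness of superposition operators -/

section Superposition

universe u

variable {K : Type*} [TopologicalSpace K] [CompactSpace K]

/-- Pointwise evaluation of a curve of continuous linear maps on a curve of vectors. -/
noncomputable def pointwiseApply {P Q : Type*} [NormedAddCommGroup P] [NormedSpace ℝ P]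
    [NormedAddCommGroup Q] [NormedSpace ℝ Q] :
    C(K, P →L[ℝ] Q) →L[ℝ] C(K, P) →L[ℝ] C(K, Q) :=
  LinearMap.mkContinuous₂
    (LinearMap.mk₂ ℝ (fun (A : C(K, P →L[ℝ] Q)) (h : C(K, P)) =>
        (⟨fun t => A t (h t), A.continuous.clm_apply h.continuous⟩ : C(K, Q)))
      (fun _ _ _ => by ext; simp) (fun _ _ _ => by ext; simp) (fun _ _ _ => by ext; simp)
      (fun _ _ _ => by ext; simp)) 1
    (fun A h => (ContinuousMap.norm_le _ (by positivity)).2 fun t => by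
      rw [one_mul]
      exact ((A t).le_opNorm _).trans
        (mul_le_mul (A.norm_coe_le_norm t) (h.norm_coe_le_norm t) (norm_nonneg _) (norm_nonneg A)))

@[simp]
lemma pointwiseApply_apply {P Q : Type*} [NormedAddCommGroup P] [NormedSpace ℝ P]
    [NormedAddCommGroup Q] [NormedSpace ℝ Q] (A : C(K, P →L[ℝ] Q)) (h : C(K, P)) (t : K) :
    pointwiseApply A h t = A t (h t) := rfl

/-- The range of `α` is compact, so `g'` is continuous there with one modulus `δ` for all `t`. The
mean value inequality on each ball of radius `δ` then bounds the remainder uniformly in `t`, hence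
in the sup norm. -/
lemma hasFDerivAt_comp_continuousMap {P Q : Type*} [NormedAddCommGroup P] [NormedSpace ℝ P]
    [NormedAddCommGroup Q] [NormedSpace ℝ Q] (g : C(P, Q)) (g' : C(P, P →L[ℝ] Q))
    (hg : ∀ p, HasFDerivAt g (g' p) p) (α : C(K, P)) :
    HasFDerivAt (fun α : C(K, P) => g.comp α) (pointwiseApply (g'.comp α)) α := by
  rw [hasFDerivAt_iff_isLittleO_nhds_zero, Asymptotics.isLittleO_iff]
  intro ε hε
  have hc := (isCompact_range α.continuous).uniformContinuousAt_of_continuousAt g'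
    (fun a _ => g'.continuous.continuousAt) (Metric.dist_mem_uniformity hε)
  obtain ⟨δ, hδ, hδ'⟩ := Metric.mem_uniformity_dist.1 hc
  filter_upwards [Metric.ball_mem_nhds (0 : C(K, P)) hδ] with h hh
  rw [mem_ball_zero_iff] at hh
  refine (ContinuousMap.norm_le _ (by positivity)).2 fun t => ?_
  have key := Convex.norm_image_sub_le_of_norm_hasFDerivWithin_le' (f := g) (f' := g')
    (s := Metric.ball (α t) δ) (C := ε) (φ := g' (α t)) (x := α t) (y := α t + h t)
    (fun x _ => (hg x).hasFDerivWithinAt) (fun x hx => by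
      have := hδ' (a := α t) (b := x) (by rwa [dist_comm]) ⟨t, rfl⟩
      rw [← dist_eq_norm, dist_comm]
      exact this.le) (convex_ball _ _) (Metric.mem_ball_self hδ) (by
      rw [Metric.mem_ball, dist_eq_norm, add_sub_cancel_left]
      exact (h.norm_coe_le_norm t).trans_lt hh)
  rw [add_sub_cancel_left] at key
  exact key.trans (mul_le_mul_of_nonneg_left (h.norm_coe_le_norm t) hε.le)

/-- The derivative is superposition by `g'` followed by the continuous linear `pointwiseApply`, so
the induction passes from `g` to `g'`. The target changes from `Q` to `P →L[ℝ] Q`; hence `Q` is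
quantified inside and shares the universe of `P`. -/
lemma contDiff_comp_continuousMap_nat {P : Type u} [NormedAddCommGroup P]
    [NormedSpace ℝ P] (n : ℕ) : ∀ {Q : Type u} [NormedAddCommGroup Q] [NormedSpace ℝ Q]
    (g : C(P, Q)), ContDiff ℝ n g → ContDiff ℝ n (fun α : C(K, P) => g.comp α) := by
  induction n with
  | zero =>
    intro Q _ _ g _
    exact contDiff_zero.2 (ContinuousMap.continuous_postcomp g)
  | succ n ih =>
    intro Q _ _ g hg
    obtain ⟨g', hg', hgg'⟩ := contDiff_succ_iff_hasFDerivAt.1 hg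
    refine contDiff_succ_iff_hasFDerivAt.2 ⟨_, ?_, fun α =>
      hasFDerivAt_comp_continuousMap g ⟨g', hg'.continuous⟩ hgg' α⟩
    exact pointwiseApply.contDiff.comp (ih ⟨g', hg'.continuous⟩ hg')

/-- Composition with a smooth map is a smooth operator between spaces of continuous curves. -/
lemma contDiff_comp_continuousMap {P Q : Type u} [NormedAddCommGroup P]
    [NormedSpace ℝ P] [NormedAddCommGroup Q] [NormedSpace ℝ Q] (g : C(P, Q))
    (hg : ContDiff ℝ ∞ g) : ContDiff ℝ ∞ (fun α : C(K, P) => g.comp α) :=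
  contDiff_infty.2 fun n => contDiff_comp_continuousMap_nat n g (contDiff_infty.1 hg n)

end Superposition

/-! ### Inverse functions and smooth fixed points -/

section InverseFunction

/-- Invertible operators form an open set, so the derivative stays invertible near `p` and the local
inverse is smooth at all nearby points. Smoothness of `f` is assumed on a neighbourhood because
`ContDiffAt` at order `∞` in a single point does not propagate to one. -/
lemma exists_smooth_localInverse {P Q : Type*} [NormedAddCommGroup P] [NormedSpace ℝ P]
    [CompleteSpace P] [NormedAddCommGroup Q] [NormedSpace ℝ Q] {f : P → Q} {p : P}
    (hf : ∀ᶠ x in 𝓝 p, ContDiffAt ℝ ∞ f x) {f' : P ≃L[ℝ] Q}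
    (hf' : HasFDerivAt f (f' : P →L[ℝ] Q) p) :
    ∃ g : Q → P, g (f p) = p ∧ (∀ᶠ y in 𝓝 (f p), f (g y) = y) ∧ (∀ᶠ x in 𝓝 p, g (f x) = x) ∧
      (∀ᶠ y in 𝓝 (f p), ContDiffAt ℝ ∞ g y) ∧
      ∀ᶠ x in 𝓝 p, ∃ e : P ≃L[ℝ] Q, HasFDerivAt f (e : P →L[ℝ] Q) x := by
  have hfp : ContDiffAt ℝ ∞ f p := hf.self_of_nhds
  let e := hfp.toOpenPartialHomeomorph f hf' (by simp)
  have hp : p ∈ e.source := hfp.mem_toOpenPartialHomeomorph_source hf' (by simp)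
  have he : ∀ x, e x = f x := fun x => rfl
  have hinv : ∀ᶠ x in 𝓝 p, ∃ e : P ≃L[ℝ] Q, HasFDerivAt f (e : P →L[ℝ] Q) x := by
    have hc : ContinuousAt (fderiv ℝ f) p :=
      (hfp.fderiv_right (m := 0) (by simp)).continuousAt
    have hn : range ((↑) : (P ≃L[ℝ] Q) → P →L[ℝ] Q) ∈ 𝓝 (fderiv ℝ f p) := by
      rw [hf'.fderiv]
      exact f'.nhds
    filter_upwards [hc.preimage_mem_nhds hn, hf] with x hx hfx
    obtain ⟨e, he⟩ := hx
    exact ⟨e, by rw [he]; exact (hfx.differentiableAt (by simp)).hasFDerivAt⟩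
  have hsymm : ContinuousAt e.symm (f p) := by
    rw [← he]
    exact e.continuousAt_symm (e.map_source hp)
  have hsp : e.symm (f p) = p := by rw [← he, e.left_inv hp]
  have htar : e.target ∈ 𝓝 (f p) := e.open_target.mem_nhds (by rw [← he]; exact e.map_source hp)
  refine ⟨e.symm, hsp, ?_, ?_, ?_, hinv⟩
  · filter_upwards [htar] with y hy
    exact e.right_inv hy
  · filter_upwards [e.open_source.mem_nhds hp] with x hx
    exact e.left_inv hx
  · have h1 := hsymm.eventually (by rw [hsp]; exact hinv)
    have h2 := hsymm.eventually (by rw [hsp]; exact hf)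
    filter_upwards [htar, h1, h2] with y hy ⟨e', he'⟩ h2
    exact e.contDiffAt_symm hy he' h2

/-- A smooth family of self-maps, one of which is constant, has a smooth family of fixed points
nearby. -/
lemma exists_smooth_fixedPoint {P C : Type*} [NormedAddCommGroup P] [NormedSpace ℝ P]
    [CompleteSpace P] [NormedAddCommGroup C] [NormedSpace ℝ C] [CompleteSpace C]
    {N : P × C → C} (hN : ContDiff ℝ ∞ N) {p₀ : P} {α₀ : C} (h₀ : ∀ α, N (p₀, α) = α₀) :
    ∃ γ : P → C, γ p₀ = α₀ ∧ ∀ᶠ p in 𝓝 p₀, ContDiffAt ℝ ∞ γ p ∧ γ p = N (p, γ p) := by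
  let D := fderiv ℝ N (p₀, α₀)
  have hD : HasFDerivAt N D (p₀, α₀) := (hN.differentiable (by simp) _).hasFDerivAt
  have hD0 : ∀ h, D (0, h) = 0 := by
    have h1 : HasFDerivAt (fun α => N (p₀, α)) (D.comp (ContinuousLinearMap.inr ℝ P C)) α₀ :=
      hD.comp α₀ (hasFDerivAt_prodMk_right p₀ α₀)
    have h2 : HasFDerivAt (fun α => N (p₀, α)) (0 : C →L[ℝ] C) α₀ := by
      simp only [h₀]
      exact hasFDerivAt_const _ _
    intro h
    exact DFunLike.congr_fun (h1.unique h2) h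
  -- Constancy of `N (p₀, ·)` kills the partial derivative in `α`, so the derivative of `(p, α) ↦
  -- (p, α - N (p, α))` is triangular with identity diagonal; no contraction estimate is needed.
  let e : (P × C) ≃L[ℝ] (P × C) := ContinuousLinearEquiv.skewProd
    (ContinuousLinearEquiv.refl ℝ P) (ContinuousLinearEquiv.refl ℝ C)
    (-(D.comp (ContinuousLinearMap.inl ℝ P C)))
  let Θ : P × C → P × C := fun q => (q.1, q.2 - N q)
  have hΘ : ContDiff ℝ ∞ Θ := contDiff_fst.prodMk (contDiff_snd.sub hN)
  have hΘ' : HasFDerivAt Θ (e : P × C →L[ℝ] P × C) (p₀, α₀) := by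
    have h : HasFDerivAt Θ ((ContinuousLinearMap.fst ℝ P C).prod
        (ContinuousLinearMap.snd ℝ P C - D)) (p₀, α₀) :=
      hasFDerivAt_fst.prodMk (hasFDerivAt_snd.sub hD)
    convert h using 1
    refine ContinuousLinearMap.ext fun ⟨a, b⟩ => ?_
    have : D (a, b) = D (a, 0) := by
      have := D.map_add (a, 0) (0, b)
      simpa [hD0] using this
    simp [e, this, sub_eq_add_neg]
  obtain ⟨g, hg0, hg1, -, hg3, -⟩ := exists_smooth_localInverse
    (Eventually.of_forall fun x => hΘ.contDiffAt) hΘ'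
  have hb : Θ (p₀, α₀) = (p₀, 0) := by simp [Θ, h₀]
  rw [hb] at hg0 hg1 hg3
  have hι : Continuous fun p : P => (p, (0 : C)) := by fun_prop
  refine ⟨fun p => (g (p, 0)).2, by simp [hg0], ?_⟩
  filter_upwards [hι.continuousAt.eventually hg1, hι.continuousAt.eventually hg3] with p h1 h3
  refine ⟨?_, ?_⟩
  · exact contDiff_snd.contDiffAt.comp p (h3.comp p (by fun_prop))
  · have h1' := Prod.ext_iff.1 h1
    simp only [Θ] at h1'
    have : g (p, 0) = (p, (g (p, 0)).2) := Prod.ext h1'.1 rfl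
    rw [← this]
    exact sub_eq_zero.1 h1'.2

end InverseFunction

end StochSym

namespace StochSym

open Set Filter Topology unitInterval

/-! ### Smooth dependence of integral curves on parameters -/

section Flow

universe u

variable {ι : Type} [Fintype ι] {X : Type u} [NormedAddCommGroup X] [NormedSpace ℝ X]

lemma contDiff_sum_smul {Z : ι → X → X} (hZ : ∀ i, ContDiff ℝ ∞ (Z i)) :
    ContDiff ℝ ∞ fun q : (ι → ℝ) × X => ∑ i, q.1 i • Z i q.2 :=
  ContDiff.sum fun i _ =>
    ((contDiff_apply ℝ ℝ i).comp contDiff_fst).smul ((hZ i).comp contDiff_snd)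

lemma fderiv_sum_smul {Z : ι → X → X} (hZ : ∀ i, ContDiff ℝ ∞ (Z i)) (q v : (ι → ℝ) × X) :
    fderiv ℝ (fun q : (ι → ℝ) × X => ∑ i, q.1 i • Z i q.2) q v =
      ∑ i, (v.1 i • Z i q.2 + q.1 i • fderiv ℝ (Z i) q.2 v.2) := by
  have h : ∀ i, HasFDerivAt (fun q : (ι → ℝ) × X => q.1 i • Z i q.2)
      (q.1 i • (fderiv ℝ (Z i) q.2).comp (ContinuousLinearMap.snd ℝ (ι → ℝ) X) +
        ((ContinuousLinearMap.proj i).comp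
          (ContinuousLinearMap.fst ℝ (ι → ℝ) X)).smulRight (Z i q.2)) q := fun i =>
    ((ContinuousLinearMap.proj i).comp (ContinuousLinearMap.fst ℝ (ι → ℝ) X)).hasFDerivAt.smul
      ((((hZ i).differentiable (by simp)) q.2).hasFDerivAt.comp q hasFDerivAt_snd)
  rw [(HasFDerivAt.fun_sum fun i _ => h i).fderiv]
  simp [add_comm]

/-- Pairing of a constant parameter with a curve. -/
noncomputable def pairCurve (A X : Type*) [NormedAddCommGroup A] [NormedSpace ℝ A]
    [NormedAddCommGroup X] [NormedSpace ℝ X] : A × C(I, X) →L[ℝ] C(I, A × X) :=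
  (((ContinuousLinearMap.inl ℝ A X).compLeftContinuous ℝ I).comp
    (ContinuousLinearMap.const ℝ I)).coprod ((ContinuousLinearMap.inr ℝ A X).compLeftContinuous ℝ I)

@[simp]
lemma pairCurve_apply {A X : Type*} [NormedAddCommGroup A] [NormedSpace ℝ A]
    [NormedAddCommGroup X] [NormedSpace ℝ X] (p : A × C(I, X)) (t : I) :
    pairCurve A X p t = (p.1, p.2 t) := by
  simp [pairCurve]

/-- Integral curves of `∑ i, a i • Z i` starting at `z`, over the unit interval, depend smoothly
on `(a, z)`, and their derivative solves the variational equation. -/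
lemma exists_smooth_integralCurves [CompleteSpace X] {Z : ι → X → X}
    (hZ : ∀ i, ContDiff ℝ ∞ (Z i)) (z₀ : X) :
    ∃ γ : (ι → ℝ) × X → C(I, X), γ (0, z₀) = ContinuousMap.const I z₀ ∧
      ∀ᶠ p in 𝓝 (0, z₀), ContDiffAt ℝ ∞ γ p ∧
        (∃ f : C(I, X), (∀ t, f t = ∑ i, p.1 i • Z i (γ p t)) ∧
          γ p = ContinuousMap.const I p.2 + volterra f) ∧
        ∀ v : (ι → ℝ) × X, ∃ f : C(I, X),
          (∀ t, f t = ∑ i, (v.1 i • Z i (γ p t) +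
            p.1 i • fderiv ℝ (Z i) (γ p t) (fderiv ℝ γ p v t))) ∧
          fderiv ℝ γ p v = ContinuousMap.const I v.2 + volterra f := by
  let g : C((ι → ℝ) × X, X) := ⟨_, (contDiff_sum_smul hZ).continuous⟩
  have hg : ContDiff ℝ ∞ g := contDiff_sum_smul hZ
  let g' : C((ι → ℝ) × X, (ι → ℝ) × X →L[ℝ] X) :=
    ⟨fderiv ℝ g, hg.continuous_fderiv (by simp)⟩
  have hgc : ∀ α : C(I, (ι → ℝ) × X),
      HasFDerivAt (fun α : C(I, (ι → ℝ) × X) => g.comp α) (pointwiseApply (g'.comp α)) α :=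
    hasFDerivAt_comp_continuousMap g g' fun p => (hg.differentiable (by simp) p).hasFDerivAt
  -- The Picard operator. With coefficients `a = 0` the integrand vanishes, so it is constant in the
  -- curve. Time is fixed to the unit interval; small `a` plays the role of short time.
  let N : ((ι → ℝ) × X) × C(I, X) → C(I, X) := fun q =>
    ContinuousLinearMap.const ℝ I q.1.2 + volterra (g.comp (pairCurve _ _ (q.1.1, q.2)))
  have hpc : ContDiff ℝ ∞ fun q : ((ι → ℝ) × X) × C(I, X) => pairCurve (ι → ℝ) X (q.1.1, q.2) :=
    (pairCurve (ι → ℝ) X).contDiff.comp (by fun_prop)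
  have hcc : ContDiff ℝ ∞ fun α : C(I, (ι → ℝ) × X) => g.comp α :=
    contDiff_comp_continuousMap g hg
  have hN : ContDiff ℝ ∞ N :=
    ((ContinuousLinearMap.const ℝ I).contDiff.comp (by fun_prop)).add
      (volterra.contDiff.comp (hcc.comp hpc))
  have hN0 : ∀ α, N ((0, z₀), α) = ContinuousMap.const I z₀ := by
    intro α
    have : g.comp (pairCurve _ _ ((0 : ι → ℝ), α)) = 0 := by
      ext t
      simp [g]
    simp only [N, this, map_zero, add_zero]
    rfl
  obtain ⟨γ, hγ0, hγ⟩ := exists_smooth_fixedPoint hN hN0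
  refine ⟨γ, hγ0, ?_⟩
  filter_upwards [hγ, hγ.eventually_nhds] with p ⟨hp1, hp2⟩ hp3
  refine ⟨hp1, ⟨_, fun t => ?_, hp2⟩, fun v => ?_⟩
  · simp [g]
  have hd : HasFDerivAt γ (fderiv ℝ γ p) p := (hp1.differentiableAt (by simp)).hasFDerivAt
  -- The fixed point identity holds on a neighbourhood of `p`, so it can be differentiated; the
  -- result is the variational equation in integral form.
  have heq : γ =ᶠ[𝓝 p] fun p => N (p, γ p) := hp3.mono fun _ h => h.2
  have hpd : HasFDerivAt (fun p => (p.1, γ p))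
      ((ContinuousLinearMap.fst ℝ (ι → ℝ) X).prod (fderiv ℝ γ p)) p := hasFDerivAt_fst.prodMk hd
  have h1 : HasFDerivAt (fun p => ContinuousLinearMap.const ℝ I p.2)
      ((ContinuousLinearMap.const ℝ I).comp (ContinuousLinearMap.snd ℝ (ι → ℝ) X)) p :=
    ((ContinuousLinearMap.const ℝ I).comp (ContinuousLinearMap.snd ℝ (ι → ℝ) X)).hasFDerivAt
  have h2 := (volterra (X := X)).hasFDerivAt.comp p ((hgc _).comp p
    ((pairCurve (ι → ℝ) X).hasFDerivAt.comp p hpd))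
  have h3 := (h1.add h2).congr_of_eventuallyEq heq
  refine ⟨pointwiseApply (g'.comp (pairCurve (ι → ℝ) X (p.1, γ p)))
    (pairCurve (ι → ℝ) X (v.1, fderiv ℝ γ p v)), fun t => ?_, ?_⟩
  · simp only [pointwiseApply_apply, ContinuousMap.comp_apply, pairCurve_apply, g', g,
      ContinuousMap.coe_mk]
    exact fderiv_sum_smul hZ _ _
  · conv_lhs => rw [hd.unique h3]
    rfl

end Flow

/-! ### Variations stay in the span of the fields -/

section Span

variable {ι : Type*} [Fintype ι] {X : Type*} [NormedAddCommGroup X] [NormedSpace ℝ X]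

/-- Duhamel's formula: β(t) = ∫₀ᵗ exp(-sA) b ds has derivative exp(-tA) b, which equals b - Aβ(t) by
the fundamental theorem of calculus. -/
lemma exists_hasDerivAt_affine {W : Type*} [NormedAddCommGroup W] [NormedSpace ℝ W]
    [CompleteSpace W] (A : W →L[ℝ] W) (b : W) :
    ∃ β : ℝ → W, β 0 = 0 ∧ ∀ t, HasDerivAt β (b - A (β t)) t := by
  have h1 : ∀ t : ℝ, HasDerivAt (fun t : ℝ => NormedSpace.exp (t • (-A)))
      ((-A) * NormedSpace.exp (t • (-A))) t := fun t => hasDerivAt_exp_smul_const' (-A) t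
  have hc : Continuous fun t : ℝ => NormedSpace.exp (t • (-A)) b :=
    (continuous_iff_continuousAt.2 fun t => (h1 t).continuousAt).clm_apply continuous_const
  have h2 : ∀ t : ℝ, HasDerivAt (fun t => ∫ s in (0 : ℝ)..t, NormedSpace.exp (s • (-A)) b)
      (NormedSpace.exp (t • (-A)) b) t := fun t =>
    intervalIntegral.integral_hasDerivAt_right (hc.intervalIntegrable _ _)
      hc.stronglyMeasurable.stronglyMeasurableAtFilter hc.continuousAt
  refine ⟨fun t => ∫ s in (0 : ℝ)..t, NormedSpace.exp (s • (-A)) b,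
    intervalIntegral.integral_same, fun t => ?_⟩
  convert h2 t using 1
  have h3 : ∀ t : ℝ, HasDerivAt (fun t : ℝ => NormedSpace.exp (t • (-A)) b)
      (-A (NormedSpace.exp (t • (-A)) b)) t := fun t => by
    simpa using (h1 t).clm_apply (hasDerivAt_const t b)
  have h4 := intervalIntegral.integral_eq_sub_of_hasDerivAt (a := 0) (b := t)
    (fun s _ => h3 s) ((A.continuous.comp hc).neg.intervalIntegrable _ _)
  rw [intervalIntegral.integral_neg, A.intervalIntegral_comp_comm (hc.intervalIntegrable _ _)] at h4
  simp only [zero_smul, NormedSpace.exp_zero, one_apply_eq_self] at h4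
  rw [sub_eq_add_neg, h4]
  abel

/-- The pointwise algebra of the variational equation, with `D i` standing for the derivative of
Z_i: the left side is the derivative of ∑ β_k Z_k along a curve of ∑ a_i Z_i, and the right side is
the variational equation. The bracket relation `hD` exchanges the two indices, and the structure
constants cancel against those in the equation for β. -/
lemma sum_structure_constants {X : Type*} [AddCommGroup X] [Module ℝ X] (D : ι → X →ₗ[ℝ] X)
    (z : ι → X) (c : ι → ι → ι → ℝ)
    (hD : ∀ i k, D k (z i) = D i (z k) + ∑ l, c i k l • z l) (a b β : ι → ℝ) :
    ∑ k, (β k • D k (∑ i, a i • z i) + (b k - ∑ i, ∑ j, a i * c i j k * β j) • z k) =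
      ∑ i, b i • z i + ∑ i, a i • D i (∑ k, β k • z k) := by
  have h1 : ∑ k, β k • D k (∑ i, a i • z i) = ∑ i, a i • D i (∑ k, β k • z k) +
      ∑ i, ∑ k, ∑ l, (a i * c i k l * β k) • z l := by
    simp only [map_sum, map_smul, Finset.smul_sum]
    rw [Finset.sum_comm, ← Finset.sum_add_distrib]
    refine Finset.sum_congr rfl fun i _ => ?_
    rw [← Finset.sum_add_distrib]
    refine Finset.sum_congr rfl fun k _ => ?_
    rw [hD, smul_add, smul_add, smul_comm]
    simp only [Finset.smul_sum, smul_smul]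
    congr 1
    refine Finset.sum_congr rfl fun l _ => ?_
    ring_nf
  have h2 : ∑ k, (∑ i, ∑ j, a i * c i j k * β j) • z k =
      ∑ i, ∑ k, ∑ l, (a i * c i k l * β k) • z l := by
    simp only [Finset.sum_smul]
    rw [Finset.sum_comm]
    exact Finset.sum_congr rfl fun i _ => Finset.sum_comm
  simp only [sub_smul, Finset.sum_add_distrib, Finset.sum_sub_distrib]
  rw [h1, h2]
  abel

/-- If the vector fields `Z i` span a Lie algebra along an integral curve `γ` of `∑ i, a i • Z i`,
then the variation of the curve with respect to the coefficients `a` lies in their span. -/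
lemma variation_mem_span [CompleteSpace X] {Z : ι → X → X} (hZ : ∀ i, ContDiff ℝ ∞ (Z i))
    (c : ι → ι → ι → ℝ) {γ J f₁ f₂ : C(I, X)} {a b : ι → ℝ} {z : X}
    (hbr : ∀ i j t, VectorField.lieBracket ℝ (Z i) (Z j) (γ t) = ∑ k, c i j k • Z k (γ t))
    (hf₁ : ∀ t, f₁ t = ∑ i, a i • Z i (γ t)) (hγ : γ = ContinuousMap.const I z + volterra f₁)
    (hf₂ : ∀ t, f₂ t = ∑ i, (b i • Z i (γ t) + a i • fderiv ℝ (Z i) (γ t) (J t)))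
    (hJ : J = volterra f₂) :
    J 1 ∈ Submodule.span ℝ (range fun k => Z k (γ 1)) := by
  let pr : ℝ → I := projIcc 0 1 zero_le_one
  -- `A β` lists the coefficients of [∑ a_i Z_i, ∑ β_k Z_k] in the Z_l.
  let A : (ι → ℝ) →L[ℝ] (ι → ℝ) := LinearMap.toContinuousLinearMap
    (LinearMap.pi fun l => ∑ i, ∑ k, (a i * c i k l) • LinearMap.proj k)
  have hA : ∀ β l, A β l = ∑ i, ∑ k, a i * c i k l * β k := fun β l => by
    simp [A, LinearMap.sum_apply]
  obtain ⟨β, hβ0, hβ⟩ := exists_hasDerivAt_affine A b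
  -- The curves are extended to all of ℝ with frozen integrand, so that two-sided derivatives exist
  -- at every time.
  let γ' : ℝ → X := fun t => z + ∫ s in (0 : ℝ)..t, f₁ (pr s)
  let J' : ℝ → X := fun t => ∫ s in (0 : ℝ)..t, f₂ (pr s)
  have hγ' : ∀ t : I, γ' t = γ t := fun t => by rw [hγ]; rfl
  have hJ' : ∀ t : I, J' t = J t := fun t => by rw [hJ]; rfl
  have hγd : ∀ t, HasDerivAt γ' (f₁ (pr t)) t := fun t =>
    (hasDerivAt_integral_projIcc f₁ t).const_add z
  have hJd : ∀ t, HasDerivAt J' (f₂ (pr t)) t := fun t => hasDerivAt_integral_projIcc f₂ t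
  let B : C(I, X →L[ℝ] X) := ⟨fun t => ∑ i, a i • fderiv ℝ (Z i) (γ t),
    continuous_finsetSum _ fun i _ => Continuous.const_smul
      (((hZ i).continuous_fderiv (by simp)).comp γ.continuous :) (a i)⟩
  let v : ℝ → X → X := fun t x => (∑ i, b i • Z i (γ (pr t))) + B (pr t) x
  have hv : ∀ t, LipschitzWith ‖B‖₊ (v t) := fun t => LipschitzWith.of_dist_le_mul fun x y => by
    rw [dist_add_left, dist_eq_norm, dist_eq_norm, ← map_sub]
    exact (B (pr t)).le_of_opNorm_le (B.norm_coe_le_norm (pr t)) _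
  -- A candidate for `J` that lies in the span by construction. It solves the same linear equation
  -- with initial value 0, so uniqueness identifies the two.
  let g : ℝ → X := fun t => ∑ k, β t k • Z k (γ' t)
  have hpr : ∀ t ∈ Ico (0 : ℝ) 1, ((pr t : I) : ℝ) = t := fun t ht =>
    congrArg Subtype.val (projIcc_of_mem zero_le_one (Ico_subset_Icc_self ht))
  have hgd : ∀ t, HasDerivAt g (∑ k, (β t k • fderiv ℝ (Z k) (γ' t) (f₁ (pr t)) +
      (b - A (β t)) k • Z k (γ' t))) t := fun t =>
    HasDerivAt.fun_sum fun k _ => ((hasDerivAt_pi.1 (hβ t) k).smul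
      (((hZ k).differentiable (by simp) _).hasFDerivAt.comp_hasDerivAt t (hγd t)))
  have hEq : EqOn J' g (Icc 0 1) := by
    refine ODE_solution_unique hv (fun t _ => (hJd t).continuousAt.continuousWithinAt)
      (fun t ht => ?_) (fun t _ => (hgd t).continuousAt.continuousWithinAt) (fun t ht => ?_) ?_
    · convert (hJd t).hasDerivWithinAt using 1
      have : J' t = J (pr t) := by rw [← hJ', hpr t ht]
      simp [v, B, hf₂, this, Finset.sum_add_distrib]
    · convert (hgd t).hasDerivWithinAt using 1
      have h1 : γ' t = γ (pr t) := by rw [← hγ', hpr t ht]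
      simp only [v, B, g, h1, hf₁, ContinuousMap.coe_mk, sum_apply, smul_apply, Pi.sub_apply, hA]
      refine (sum_structure_constants (fun i => (fderiv ℝ (Z i) (γ (pr t)) : X →ₗ[ℝ] X))
        (fun i => Z i (γ (pr t))) c (fun i k => ?_) a b (β t)).symm
      rw [← hbr, VectorField.lieBracket]
      simp
    · simp [J', g, hβ0]
  have h1 := hEq (right_mem_Icc.2 zero_le_one)
  have e1 : J' 1 = J 1 := hJ' 1
  have e2 : γ' 1 = γ 1 := hγ' 1
  rw [← e1, h1]
  simp only [g, e2]
  exact Submodule.sum_mem _ fun k _ =>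
    Submodule.smul_mem _ _ (Submodule.subset_span ⟨k, rfl⟩)

end Span

end StochSym

/-! ### A local Frobenius theorem -/

namespace StochSym

open Set Filter Topology unitInterval

/-- Multiplication by a bump function supported inside the ball of smoothness. It provides the
globally smooth fields on which superposition operators are defined. -/
lemma exists_contDiff_eventuallyEq {X W : Type*} [NormedAddCommGroup X] [NormedSpace ℝ X]
    [FiniteDimensional ℝ X] [NormedAddCommGroup W] [NormedSpace ℝ W] {f : X → W} {z : X}
    (hf : ∀ᶠ x in 𝓝 z, ContDiffAt ℝ ∞ f x) : ∃ g : X → W, ContDiff ℝ ∞ g ∧ g =ᶠ[𝓝 z] f := by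
  obtain ⟨ε, hε, h⟩ := Metric.eventually_nhds_iff_ball.1 hf
  let φ : ContDiffBump z := ⟨ε / 4, ε / 2, by positivity, by linarith⟩
  refine ⟨fun x => φ x • f x, contDiff_iff_contDiffAt.2 fun x => ?_, ?_⟩
  · by_cases hx : x ∈ Metric.ball z ε
    · exact φ.contDiffAt.smul (h x hx)
    · have hx' : x ∉ tsupport φ := by
        rw [φ.tsupport_eq]
        intro hx'
        exact hx (Metric.closedBall_subset_ball (by simp only [φ]; linarith) hx')
      have : (fun x => φ x • f x) =ᶠ[𝓝 x] fun _ => 0 := by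
        filter_upwards [notMem_tsupport_iff_eventuallyEq.1 hx'] with y hy
        simp [hy]
      exact contDiffAt_const.congr_of_eventuallyEq this
  · filter_upwards [φ.eventuallyEq_one] with x hx
    simp [hx]

section Frobenius

variable {ι : Type} [Fintype ι] {E H : Type*} [NormedAddCommGroup E] [NormedSpace ℝ E]
  [FiniteDimensional ℝ E] [NormedAddCommGroup H] [NormedSpace ℝ H]

/-- The complement is the kernel of a left inverse of a ↦ ∑ a_i y_i. It serves as the transversal of
initial points. -/
lemma exists_complement_equiv {y : ι → E} (hy : LinearIndependent ℝ y) :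
    ∃ (N : Submodule ℝ E) (e : ((ι → ℝ) × N) ≃L[ℝ] E), ∀ a n, e (a, n) = ∑ i, a i • y i + n := by
  classical
  let L : (ι → ℝ) →ₗ[ℝ] E := Fintype.linearCombination ℝ y
  obtain ⟨P, hP⟩ := L.exists_leftInverse_of_injective
    (LinearMap.ker_eq_bot.2 (hy.fintypeLinearCombination_injective))
  have hPL : ∀ a, P (L a) = a := fun a => LinearMap.congr_fun hP a
  have hbij : Function.Bijective (L.coprod (LinearMap.ker P).subtype) := by
    constructor
    · rw [← LinearMap.ker_eq_bot, LinearMap.ker_eq_bot']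
      rintro ⟨a, n⟩ h
      simp only [LinearMap.coprod_apply, Submodule.subtype_apply] at h
      have ha : a = 0 := by
        have := congrArg P h
        simpa [hPL] using this
      subst ha
      simpa using h
    · intro x
      refine ⟨(P x, ⟨x - L (P x), by simp [hPL]⟩), by simp⟩
  refine ⟨LinearMap.ker P, (LinearEquiv.ofBijective _ hbij).toContinuousLinearEquiv,
    fun a n => ?_⟩
  simp [L, Fintype.linearCombination_apply]

lemma eventually_forall_continuousMap {X : Type*} [NormedAddCommGroup X] {z : X} {p : X → Prop}
    (hp : ∀ᶠ x in 𝓝 z, p x) : ∀ᶠ α in 𝓝 (ContinuousMap.const I z), ∀ t, p (α t) := by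
  obtain ⟨ε, hε, h⟩ := Metric.eventually_nhds_iff_ball.1 hp
  filter_upwards [Metric.ball_mem_nhds _ hε] with α hα t
  exact h _ ((ContinuousMap.dist_apply_le_dist t).trans_lt hα)

/-- Let Ψ(a, n) be the time-one point of the integral curve of ∑ a_i Z_i from (x₀ + n, h₀), with n
in a complement of the span of the y_i(x₀). Its E-component is a local diffeomorphism, so the image
of Ψ is a graph. The image is a union of leaves through the transversal, hence tangent to each Z_i.
-/
theorem exists_tangent_graph_of_contDiff [CompleteSpace H] {Z : ι → E × H → E × H}
    (hZ : ∀ i, ContDiff ℝ ∞ (Z i)) {x₀ : E} {h₀ : H} {y : ι → E → E}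
    (hy : ∀ i, ∀ᶠ p in 𝓝 (x₀, h₀), (Z i p).1 = y i p.1)
    (hlin : LinearIndependent ℝ fun i => y i x₀) (c : ι → ι → ι → ℝ)
    (hbr : ∀ i j, ∀ᶠ p in 𝓝 (x₀, h₀),
      VectorField.lieBracket ℝ (Z i) (Z j) p = ∑ k, c i j k • Z k p) :
    ∃ u : E → H, u x₀ = h₀ ∧ ∀ᶠ x in 𝓝 x₀, ContDiffAt ℝ ∞ u x ∧
      ∀ i, fderiv ℝ u x (y i x) = (Z i (x, u x)).2 := by
  obtain ⟨γ, hγ0, hγ⟩ := exists_smooth_integralCurves hZ (x₀, h₀)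
  obtain ⟨N, e, he⟩ := exists_complement_equiv hlin
  let l : ((ι → ℝ) × N) →L[ℝ] (ι → ℝ) × (E × H) :=
    (ContinuousLinearMap.fst ℝ (ι → ℝ) N).prod
      ((N.subtypeL.comp (ContinuousLinearMap.snd ℝ (ι → ℝ) N)).prod 0)
  let j : ((ι → ℝ) × N) → (ι → ℝ) × (E × H) := fun q => (0, (x₀, h₀)) + l q
  have hj : ContDiff ℝ ∞ j := contDiff_const.add l.contDiff
  have hj' : ∀ q, HasFDerivAt j l q := fun q => l.hasFDerivAt.const_add _
  have hj0 : j 0 = (0, (x₀, h₀)) := by simp [j]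
  let ev : C(I, E × H) →L[ℝ] E × H := ContinuousMap.evalCLM ℝ 1
  let Ψ : ((ι → ℝ) × N) → E × H := fun q => ev (γ (j q))
  have hΨ0 : Ψ 0 = (x₀, h₀) := by simp only [Ψ, hj0, hγ0]; rfl
  have hΨd : ∀ q, DifferentiableAt ℝ γ (j q) →
      HasFDerivAt Ψ (ev.comp ((fderiv ℝ γ (j q)).comp l)) q := fun q hq =>
    ev.hasFDerivAt.comp q (hq.hasFDerivAt.comp q (hj' q))
  have hjt : Tendsto j (𝓝 0) (𝓝 (0, (x₀, h₀))) := hj0 ▸ hj.continuous.tendsto 0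
  have hjγ := hjt.eventually hγ
  have hψs : ∀ᶠ q in 𝓝 (0 : (ι → ℝ) × N), ContDiffAt ℝ ∞ (fun q => (Ψ q).1) q := by
    filter_upwards [hjγ] with q hq
    exact contDiff_fst.contDiffAt.comp q
      (ev.contDiff.contDiffAt.comp q (hq.1.comp q hj.contDiffAt))
  have hψ' : HasFDerivAt (fun q => (Ψ q).1) (e : ((ι → ℝ) × N) →L[ℝ] E) 0 := by
    have h0 := hγ.self_of_nhds
    rw [← hj0] at h0
    have h1 := hasFDerivAt_fst.comp (0 : (ι → ℝ) × N)
      (hΨd 0 (h0.1.differentiableAt (by simp)))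
    -- At `a = 0` the curve is constant, so the variational integrand is the constant ∑ a_i Z_i(x₀,
    -- h₀), and the end point varies by (n, 0) + ∑ a_i Z_i(x₀, h₀).
    refine h1.congr_fderiv (ContinuousLinearMap.ext fun ⟨a, n⟩ => Eq.symm ?_)
    obtain ⟨f, hf, hf'⟩ := h0.2.2 (l (a, n))
    have hfc : f = ContinuousMap.const I (∑ i, a i • Z i (x₀, h₀)) := by
      ext1 t
      rw [hf, hj0, hγ0]
      simp [l]
    have h2 : ev (fderiv ℝ γ (j 0) (l (a, n))) = (l (a, n)).2 + ∑ i, a i • Z i (x₀, h₀) := by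
      rw [hf', hfc, map_add]
      congr 1
      exact volterra_const_one _
    have h3 : ∀ i, (Z i (x₀, h₀)).1 = y i x₀ := fun i => (hy i).self_of_nhds
    change e (a, n) = (ev (fderiv ℝ γ (j 0) (l (a, n)))).1
    rw [h2, he]
    simp [l, Prod.fst_sum, h3, add_comm]
  obtain ⟨φ, hφ0, hφ1, hφ2, hφ3, hφ4⟩ := exists_smooth_localInverse hψs hψ'
  have hψ0 : (Ψ 0).1 = x₀ := by rw [hΨ0]
  rw [hψ0] at hφ0 hφ1 hφ3
  have hcurve : ∀ᶠ q in 𝓝 (0 : (ι → ℝ) × N), ∀ t, (∀ i, (Z i (γ (j q) t)).1 = y i (γ (j q) t).1) ∧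
      ∀ i k, VectorField.lieBracket ℝ (Z i) (Z k) (γ (j q) t) =
        ∑ m, c i k m • Z m (γ (j q) t) := by
    have h1 : ∀ᶠ p in 𝓝 (x₀, h₀), (∀ i, (Z i p).1 = y i p.1) ∧
        ∀ i k, VectorField.lieBracket ℝ (Z i) (Z k) p = ∑ m, c i k m • Z m p :=
      (eventually_all.2 hy).and (eventually_all.2 fun i => eventually_all.2 (hbr i))
    have h2 : ContinuousAt (fun q => γ (j q)) 0 := by
      have := hγ.self_of_nhds.1.continuousAt
      rw [← hj0] at this
      exact this.comp hj.continuous.continuousAt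
    have h3 := eventually_forall_continuousMap h1
    rw [← hγ0, ← hj0] at h3
    exact h2.eventually h3
  -- The a-derivative of Ψ maps into the span of the Z_k(Ψ q), of dimension at most |ι|, and is
  -- injective because its E-component is. Hence it is onto the span, and every Z_i(Ψ q) is tangent
  -- to the image.
  have hgood : ∀ᶠ q in 𝓝 (0 : (ι → ℝ) × N), ∀ i, ∃ b : ι → ℝ,
      ev (fderiv ℝ γ (j q) (l (b, 0))) = Z i (Ψ q) := by
    filter_upwards [hjγ, hcurve, hφ4] with q hq1 hq2 ⟨e', he'⟩
    let T : (ι → ℝ) →ₗ[ℝ] E × H :=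
      (ev.comp ((fderiv ℝ γ (j q)).comp l)).toLinearMap.comp (LinearMap.inl ℝ (ι → ℝ) N)
    have hT : ∀ b, (T b).1 = e' (b, 0) := fun b => by
      have := he'.unique (hasFDerivAt_fst.comp q (hΨd q (hq1.1.differentiableAt (by simp))))
      exact (DFunLike.congr_fun this (b, 0)).symm
    have hTi : Function.Injective T := fun b b' h => by
      have h1 : e' (b, 0) = e' (b', 0) := by rw [← hT, ← hT, h]
      exact (Prod.ext_iff.1 (e'.injective h1)).1
    have hle : LinearMap.range T ≤ Submodule.span ℝ (range fun k => Z k (Ψ q)) := by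
      rintro _ ⟨b, rfl⟩
      obtain ⟨f₁, hf₁, hγ₁⟩ := hq1.2.1
      obtain ⟨f₂, hf₂, hJ⟩ := hq1.2.2 (l (b, 0))
      refine variation_mem_span hZ c (b := b) (J := fderiv ℝ γ (j q) (l (b, 0)))
        (fun i k t => (hq2 t).2 i k) hf₁ hγ₁ hf₂ ?_
      rw [hJ]
      have : ContinuousMap.const I (l (b, 0)).2 = (0 : C(I, E × H)) := by
        ext1 t
        simp [l]
      rw [this, zero_add]
    have hfin : FiniteDimensional ℝ (Submodule.span ℝ (range fun k => Z k (Ψ q))) :=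
      FiniteDimensional.span_of_finite ℝ (finite_range _)
    have heq := Submodule.eq_of_le_of_finrank_le hle (by
      rw [LinearMap.finrank_range_of_inj hTi, Module.finrank_fintype_fun_eq_card]
      exact finrank_range_le_card _)
    intro i
    have hi : Z i (Ψ q) ∈ LinearMap.range T := by
      rw [heq]
      exact Submodule.subset_span ⟨i, rfl⟩
    exact hi
  have hφc : Tendsto φ (𝓝 x₀) (𝓝 0) := by
    have := hφ3.self_of_nhds.continuousAt.tendsto
    rwa [hφ0] at this
  refine ⟨fun x => (Ψ (φ x)).2, by simp [hφ0, hΨ0], ?_⟩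
  have hall := hφc.eventually (hjγ.and (hcurve.and (hgood.and (hφ2.eventually_nhds.and hψs))))
  filter_upwards [hall, hφ1, hφ3] with x ⟨hq1, hq2, hq3, hq4, hq5⟩ hx1 hx3
  have hΨs : ContDiffAt ℝ ∞ Ψ (φ x) :=
    ev.contDiff.contDiffAt.comp _ (hq1.1.comp _ hj.contDiffAt)
  have hus : ContDiffAt ℝ ∞ (fun x => (Ψ (φ x)).2) x :=
    contDiff_snd.contDiffAt.comp x (hΨs.comp x hx3)
  refine ⟨hus, fun i => ?_⟩
  obtain ⟨b, hb⟩ := hq3 i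
  have hΨ' := hΨd (φ x) (hq1.1.differentiableAt (by simp))
  have hpair : (x, (Ψ (φ x)).2) = Ψ (φ x) := Prod.ext hx1.symm rfl
  have hy' : (Z i (Ψ (φ x))).1 = y i x := by
    have := (hq2 1).1 i
    rw [show γ (j (φ x)) 1 = Ψ (φ x) from rfl] at this
    rw [this, hx1]
  -- The H-component of Ψ is differentiated in two ways, as u composed with the E-component and
  -- directly. On the direction `(b, 0)`, where the derivative of Ψ is Z_i, the comparison gives the
  -- equation for u.
  have h1 : HasFDerivAt (fun q => (Ψ (φ (Ψ q).1)).2)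
      ((fderiv ℝ (fun x => (Ψ (φ x)).2) x).comp
        ((ContinuousLinearMap.fst ℝ E H).comp (ev.comp ((fderiv ℝ γ (j (φ x))).comp l)))) (φ x) := by
    have h2 : HasFDerivAt (fun x => (Ψ (φ x)).2) (fderiv ℝ (fun x => (Ψ (φ x)).2) x)
        (Ψ (φ x)).1 := by
      rw [hx1]
      exact (hus.differentiableAt (by simp)).hasFDerivAt
    exact h2.comp (φ x) (hasFDerivAt_fst.comp (φ x) hΨ')
  have h2 : HasFDerivAt (fun q => (Ψ (φ (Ψ q).1)).2)
      ((ContinuousLinearMap.snd ℝ E H).comp (ev.comp ((fderiv ℝ γ (j (φ x))).comp l))) (φ x) :=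
    (hasFDerivAt_snd.comp (φ x) hΨ').congr_of_eventuallyEq (hq4.mono fun q hq => by
      simp only [Function.comp_apply, hq])
  have h3 := DFunLike.congr_fun (h1.unique h2) (b, 0)
  simp only [ContinuousLinearMap.comp_apply] at h3
  rw [hb] at h3
  simp only [ContinuousLinearMap.coe_fst',
    ContinuousLinearMap.coe_snd', hy'] at h3
  rw [h3, hpair]

/-- A local form of the Frobenius theorem: if vector fields on `E × H` span a Lie algebra (with
constant structure coefficients), and project to linearly independent fields on `E`, then there is
a graph over `E` through a given point, to which they are tangent. -/
theorem exists_tangent_graph [FiniteDimensional ℝ H] {Z : ι → E × H → E × H} {x₀ : E} {h₀ : H}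
    (hZ : ∀ i, ∀ᶠ p in 𝓝 (x₀, h₀), ContDiffAt ℝ ∞ (Z i) p) {y : ι → E → E}
    (hy : ∀ i, ∀ᶠ p in 𝓝 (x₀, h₀), (Z i p).1 = y i p.1)
    (hlin : LinearIndependent ℝ fun i => y i x₀) (c : ι → ι → ι → ℝ)
    (hbr : ∀ i j, ∀ᶠ p in 𝓝 (x₀, h₀),
      VectorField.lieBracket ℝ (Z i) (Z j) p = ∑ k, c i j k • Z k p) :
    ∃ u : E → H, u x₀ = h₀ ∧ ∀ᶠ x in 𝓝 x₀, ContDiffAt ℝ ∞ u x ∧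
      ∀ i, fderiv ℝ u x (y i x) = (Z i (x, u x)).2 := by
  -- Brackets and the conclusion depend only on germs, so the fields may be replaced by global ones.
  choose Z' hZ' hZZ' using fun i => exists_contDiff_eventuallyEq (hZ i)
  have := FiniteDimensional.complete ℝ H
  obtain ⟨u, hu0, hu⟩ := exists_tangent_graph_of_contDiff hZ' (x₀ := x₀) (h₀ := h₀) (y := y)
    (fun i => by filter_upwards [hy i, hZZ' i] with p h1 h2; rw [h2, h1]) hlin c
    (fun i j => by
      filter_upwards [hbr i j, (hZZ' i).eventually_nhds, (hZZ' j).eventually_nhds,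
        eventually_all.2 hZZ'] with p h1 h2 h3 h4
      rw [Filter.EventuallyEq.lieBracket_vectorField_eq h2 h3, h1]
      simp only [h4])
  refine ⟨u, hu0, ?_⟩
  have hc : Tendsto (fun x => (x, u x)) (𝓝 x₀) (𝓝 (x₀, h₀)) := by
    have := (continuousAt_id.prodMk hu.self_of_nhds.1.continuousAt : ContinuousAt
      (fun x => (x, u x)) x₀).tendsto
    rwa [hu0] at this
  have hev := hc.eventually (eventually_all.2 hZZ')
  filter_upwards [hu, hev] with x h1 h2
  exact ⟨h1.1, fun i => by rw [h1.2 i, h2 i]⟩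

end Frobenius

end StochSym

namespace StochSym

open Set Filter Topology

/-! ### From zero curvature to tangent graphs -/

section ZeroCurvature

variable {ι : Type} [Fintype ι] {E F H : Type*} [NormedAddCommGroup E] [NormedSpace ℝ E]
  [FiniteDimensional ℝ E] [NormedAddCommGroup F] [NormedSpace ℝ F]
  [NormedAddCommGroup H] [NormedSpace ℝ H] [FiniteDimensional ℝ H]

/-- Local solvability of `Y i (u) = -Λ_u (C i)` when `C` satisfies a zero curvature condition
with respect to the Lie algebra spanned by the fields `Λ v`. -/
theorem exists_parallel {y : ι → E → E} {C : ι → E → F} {Λ : H → F →L[ℝ] H} {br : F → F → F}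
    {x₀ : E} {h₀ : H} (c : ι → ι → ι → ℝ)
    (hy : ∀ i, ∀ᶠ x in 𝓝 x₀, ContDiffAt ℝ ∞ (y i) x)
    (hC : ∀ i, ∀ᶠ x in 𝓝 x₀, ContDiffAt ℝ ∞ (C i) x)
    (hΛ : ∀ᶠ h in 𝓝 h₀, ContDiffAt ℝ ∞ Λ h)
    (hlin : LinearIndependent ℝ fun i => y i x₀)
    (hybr : ∀ i j, ∀ᶠ x in 𝓝 x₀,
      VectorField.lieBracket ℝ (y i) (y j) x = ∑ k, c i j k • y k x)
    (hΛbr : ∀ᶠ h in 𝓝 h₀, ∀ v w,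
      VectorField.lieBracket ℝ (fun h => Λ h v) (fun h => Λ h w) h = Λ h (br v w))
    (hflat : ∀ i j, ∀ᶠ x in 𝓝 x₀, fderiv ℝ (C j) x (y i x) - fderiv ℝ (C i) x (y j x) -
      br (C i x) (C j x) = ∑ k, c i j k • C k x) :
    ∃ u : E → H, u x₀ = h₀ ∧ ∀ᶠ x in 𝓝 x₀, ContDiffAt ℝ ∞ u x ∧
      ∀ i, fderiv ℝ u x (y i x) = -Λ (u x) (C i x) := by
  have tE : Tendsto Prod.fst (𝓝 (x₀, h₀)) (𝓝 x₀) := continuous_fst.tendsto (x₀, h₀)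
  have tH : Tendsto Prod.snd (𝓝 (x₀, h₀)) (𝓝 h₀) := continuous_snd.tendsto (x₀, h₀)
  -- The H-component of [Z_i, Z_j] is -Λ(y_i(C_j) - y_j(C_i)) + Λ(br(C_i, C_j)), the two signs
  -- cancelling in the bracket of the vertical parts. By `hflat` it equals -Λ(∑ c_ijk C_k), so the
  -- lifted fields close with the same constants.
  refine exists_tangent_graph (Z := fun i p => (y i p.1, -Λ p.2 (C i p.1))) (fun i => ?_)
    (fun i => Eventually.of_forall fun _ => rfl) hlin c fun i j => ?_
  · filter_upwards [tE.eventually (hy i), tE.eventually (hC i), tH.eventually hΛ] with p h1 h2 h3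
    exact (h1.comp p contDiffAt_fst).prodMk
      ((h3.comp p contDiffAt_snd).clm_apply (h2.comp p contDiffAt_fst)).neg
  · have hd : ∀ i, ∀ᶠ p in 𝓝 (x₀, h₀), ∀ v w,
        fderiv ℝ (fun p : E × H => (y i p.1, -Λ p.2 (C i p.1))) p (v, w) =
          (fderiv ℝ (y i) p.1 v, -(fderiv ℝ Λ p.2 w (C i p.1) + Λ p.2 (fderiv ℝ (C i) p.1 v))) := by
      intro i
      filter_upwards [tE.eventually (hy i), tE.eventually (hC i), tH.eventually hΛ]
        with p h1 h2 h3 v w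
      have d1 := (h1.differentiableAt (by simp)).hasFDerivAt.comp p (hasFDerivAt_fst (𝕜 := ℝ))
      have d2 := (h2.differentiableAt (by simp)).hasFDerivAt.comp p (hasFDerivAt_fst (𝕜 := ℝ))
      have d3 := (h3.differentiableAt (by simp)).hasFDerivAt.comp p (hasFDerivAt_snd (𝕜 := ℝ))
      have := (d1.prodMk (d3.clm_apply d2).neg).fderiv
      simp only [Function.comp_apply] at this
      erw [this]
      simp [add_comm]
    have hc : ∀ᶠ h in 𝓝 h₀, ∀ v w, fderiv ℝ (fun h => Λ h v) h w = fderiv ℝ Λ h w v := by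
      filter_upwards [hΛ] with h hh v w
      have := ((hh.differentiableAt (by simp)).hasFDerivAt.clm_apply (hasFDerivAt_const v h)).fderiv
      rw [this]
      simp
    filter_upwards [hd i, hd j, tE.eventually (hybr i j), tH.eventually hΛbr,
      tE.eventually (hflat i j), tH.eventually hc] with p h1 h2 h3 h4 h5 h6
    have h4' := h4 (C i p.1) (C j p.1)
    simp only [VectorField.lieBracket, h6] at h4'
    have hfst : (∑ k, c i j k • ((y k p.1, -Λ p.2 (C k p.1)) : E × H)).1 =
        ∑ k, c i j k • y k p.1 := by simp [Prod.fst_sum]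
    have hsnd : (∑ k, c i j k • ((y k p.1, -Λ p.2 (C k p.1)) : E × H)).2 =
        -Λ p.2 (∑ k, c i j k • C k p.1) := by simp [Prod.snd_sum]
    rw [VectorField.lieBracket, h1, h2]
    refine Prod.ext ?_ ?_
    · rw [hfst, ← h3]
      rfl
    · rw [hsnd, ← h5, map_sub, map_sub, ← h4']
      simp only [Prod.snd_sub, map_neg, neg_apply]
      abel

end ZeroCurvature

/-! ### Vector fields read in a chart -/

section ChartField

variable {E : Type*} [NormedAddCommGroup E] [NormedSpace ℝ E]
  {M : Type*} [TopologicalSpace M] [ChartedSpace E M]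

lemma mlieBracket_eq_lieBracket (Y₁ Y₂ : (x : E) → TangentSpace 𝓘(ℝ, E) x) (p : E) :
    VectorField.mlieBracket 𝓘(ℝ, E) Y₁ Y₂ p = VectorField.lieBracket ℝ Y₁ Y₂ p :=
  (congrFun (VectorField.mlieBracketWithin_univ (I := 𝓘(ℝ, E)) (V := Y₁) (W := Y₂)).symm p).trans
    ((congrFun (VectorField.mlieBracketWithin_eq_lieBracketWithin (𝕜 := ℝ) (s := univ)) p).trans
      (congrFun VectorField.lieBracketWithin_univ p))

/-- The expression of a vector field in the preferred chart at `x₀`. -/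
noncomputable def chartField (x₀ : M) (Y : (x : M) → TangentSpace 𝓘(ℝ, E) x) (p : E) : E :=
  VectorField.mpullback 𝓘(ℝ, E) 𝓘(ℝ, E) (extChartAt 𝓘(ℝ, E) x₀).symm Y p

variable [IsManifold 𝓘(ℝ, E) ∞ M] {x₀ : M} {p : E}

lemma contMDiffAt_extChartAt_symm_of_mem (hp : p ∈ (extChartAt 𝓘(ℝ, E) x₀).target) :
    ContMDiffAt 𝓘(ℝ, E) 𝓘(ℝ, E) ∞ (extChartAt 𝓘(ℝ, E) x₀).symm p :=
  (contMDiffOn_extChartAt_symm x₀).contMDiffAt ((isOpen_extChartAt_target x₀).mem_nhds hp)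

lemma isInvertible_mfderiv_extChartAt_symm_of_mem (hp : p ∈ (extChartAt 𝓘(ℝ, E) x₀).target) :
    (mfderiv 𝓘(ℝ, E) 𝓘(ℝ, E) (extChartAt 𝓘(ℝ, E) x₀).symm p).IsInvertible := by
  have := isInvertible_mfderivWithin_extChartAt_symm (I := 𝓘(ℝ, E)) hp
  simpa using this

lemma mfderiv_symm_chartField (hp : p ∈ (extChartAt 𝓘(ℝ, E) x₀).target)
    (Y : (x : M) → TangentSpace 𝓘(ℝ, E) x) :
    mfderiv 𝓘(ℝ, E) 𝓘(ℝ, E) (extChartAt 𝓘(ℝ, E) x₀).symm p (chartField (E := E) x₀ Y p) =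
      Y ((extChartAt 𝓘(ℝ, E) x₀).symm p) := by
  obtain ⟨e, he⟩ := isInvertible_mfderiv_extChartAt_symm_of_mem hp
  unfold chartField
  rw [VectorField.mpullback_apply, ← he, ContinuousLinearMap.inverse_equiv]
  exact e.apply_symm_apply _

lemma mfderiv_extChartAt_eq_chartField {x : M} (hx : x ∈ (extChartAt 𝓘(ℝ, E) x₀).source)
    (Y : (x : M) → TangentSpace 𝓘(ℝ, E) x) :
    mfderiv 𝓘(ℝ, E) 𝓘(ℝ, E) (extChartAt 𝓘(ℝ, E) x₀) x (Y x) =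
      chartField (E := E) x₀ Y (extChartAt 𝓘(ℝ, E) x₀ x) := by
  have hp := (extChartAt 𝓘(ℝ, E) x₀).map_source hx
  have h := mfderiv_symm_chartField hp Y
  have h2 := mfderiv_extChartAt_comp_mfderivWithin_extChartAt_symm (I := 𝓘(ℝ, E)) hp
  simp only [modelWithCornersSelf_coe, range_id, mfderivWithin_univ] at h2
  have h3 := DFunLike.congr_fun h2 (chartField (E := E) x₀ Y (extChartAt 𝓘(ℝ, E) x₀ x))
  have h4 := (congrArg (mfderiv 𝓘(ℝ, E) 𝓘(ℝ, E) (extChartAt 𝓘(ℝ, E) x₀)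
    ((extChartAt 𝓘(ℝ, E) x₀).symm (extChartAt 𝓘(ℝ, E) x₀ x))) h).symm.trans h3
  rwa [(extChartAt 𝓘(ℝ, E) x₀).left_inv hx] at h4

lemma fderiv_comp_symm_chartField {W : Type*} [NormedAddCommGroup W] [NormedSpace ℝ W]
    (hp : p ∈ (extChartAt 𝓘(ℝ, E) x₀).target) {f : M → W}
    (hf : MDifferentiableAt 𝓘(ℝ, E) 𝓘(ℝ, W) f ((extChartAt 𝓘(ℝ, E) x₀).symm p))
    (Y : (x : M) → TangentSpace 𝓘(ℝ, E) x) :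
    fderiv ℝ (f ∘ (extChartAt 𝓘(ℝ, E) x₀).symm) p (chartField (E := E) x₀ Y p) =
      derivAlong Y f ((extChartAt 𝓘(ℝ, E) x₀).symm p) := by
  have h := mfderiv_comp p hf
    ((contMDiffAt_extChartAt_symm_of_mem hp).mdifferentiableAt (by simp))
  rw [mfderiv_eq_fderiv] at h
  exact (DFunLike.congr_fun h (chartField (E := E) x₀ Y p)).trans
    (congrArg (mfderiv 𝓘(ℝ, E) 𝓘(ℝ, W) f ((extChartAt 𝓘(ℝ, E) x₀).symm p))
      (mfderiv_symm_chartField hp Y))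

variable [CompleteSpace E]

lemma contDiffAt_chartField (hp : p ∈ (extChartAt 𝓘(ℝ, E) x₀).target)
    {Y : (x : M) → TangentSpace 𝓘(ℝ, E) x}
    (hY : ContMDiff 𝓘(ℝ, E) 𝓘(ℝ, E).tangent ∞
      (fun x => (⟨x, Y x⟩ : TangentBundle 𝓘(ℝ, E) M))) :
    ContDiffAt ℝ ∞ (chartField (E := E) x₀ Y) p :=
  contMDiffAt_vectorSpace_iff_contDiffAt.1 (ContMDiffAt.mpullback_vectorField_preimage
    (n := ∞) hY.contMDiffAt (contMDiffAt_extChartAt_symm_of_mem hp)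
    (isInvertible_mfderiv_extChartAt_symm_of_mem hp) le_rfl)

/-- Naturality of the Lie bracket under pullback by the inverse chart. -/
lemma lieBracket_chartField (hp : p ∈ (extChartAt 𝓘(ℝ, E) x₀).target)
    {Y₁ Y₂ : (x : M) → TangentSpace 𝓘(ℝ, E) x}
    (hY₁ : ContMDiff 𝓘(ℝ, E) 𝓘(ℝ, E).tangent ∞
      (fun x => (⟨x, Y₁ x⟩ : TangentBundle 𝓘(ℝ, E) M)))
    (hY₂ : ContMDiff 𝓘(ℝ, E) 𝓘(ℝ, E).tangent ∞
      (fun x => (⟨x, Y₂ x⟩ : TangentBundle 𝓘(ℝ, E) M))) :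
    VectorField.lieBracket ℝ (chartField (E := E) x₀ Y₁) (chartField (E := E) x₀ Y₂) p =
      chartField (E := E) x₀ (VectorField.mlieBracket 𝓘(ℝ, E) Y₁ Y₂) p := by
  have : IsManifold 𝓘(ℝ, E) (minSmoothness ℝ 2) M := by
    rw [minSmoothness_of_isRCLikeNormedField]
    infer_instance
  have : IsManifold 𝓘(ℝ, E) (minSmoothness ℝ 3) M := by
    rw [minSmoothness_of_isRCLikeNormedField]
    infer_instance
  have h := VectorField.mpullback_mlieBracket (n := ∞) (x₀ := p)
    (hY₁.contMDiffAt.mdifferentiableAt (by simp)) (hY₂.contMDiffAt.mdifferentiableAt (by simp))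
    (contMDiffAt_extChartAt_symm_of_mem hp) (by
      rw [minSmoothness_of_isRCLikeNormedField]
      exact ENat.LEInfty.out)
  exact (mlieBracket_eq_lieBracket _ _ p).symm.trans h.symm

end ChartField

end StochSym

namespace StochSym

open Set Filter Topology

/-! ### Left invariant fields in the chart at the identity -/

section LieGroup

variable {F : Type*} [NormedAddCommGroup F] [NormedSpace ℝ F]
  {G : Type*} [TopologicalSpace G] [ChartedSpace F G] [Group G]

variable (F G) in
/-- The left invariant vector fields of `G` in the preferred chart at the identity: the value at
`q` of the field associated with `v` is `invariantFrame q v`. -/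
noncomputable def invariantFrame (q : F) : F →L[ℝ] F :=
  ContinuousLinearMap.comp (M₂ := F)
    (mfderiv 𝓘(ℝ, F) 𝓘(ℝ, F) (extChartAt 𝓘(ℝ, F) (1 : G)).symm q).inverse
    (mfderiv 𝓘(ℝ, F) 𝓘(ℝ, F) (fun h : G => (extChartAt 𝓘(ℝ, F) (1 : G)).symm q * h) 1)

variable (F G) in
/-- The bracket of the Lie algebra of `G`, on the model space. -/
noncomputable def modelBracket (v w : F) : F :=
  Bracket.bracket (L := GroupLieAlgebra 𝓘(ℝ, F) G) (M := GroupLieAlgebra 𝓘(ℝ, F) G) v w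

variable [LieGroup 𝓘(ℝ, F) ∞ G]

/-- The field is the tangent map of multiplication evaluated on the pair (zero vector at g, v at 1),
a composite of smooth maps. -/
theorem contMDiff_infty_mulInvariantVectorField (v : GroupLieAlgebra 𝓘(ℝ, F) G) :
    ContMDiff 𝓘(ℝ, F) 𝓘(ℝ, F).tangent ∞
      (fun g : G => (⟨g, mulInvariantVectorField v g⟩ : TangentBundle 𝓘(ℝ, F) G)) := by
  let fg : G → TangentBundle 𝓘(ℝ, F) G := fun g => Bundle.TotalSpace.mk' F g 0
  have sfg : ContMDiff 𝓘(ℝ, F) 𝓘(ℝ, F).tangent ∞ fg := Bundle.contMDiff_zeroSection _ _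
  let fv : G → TangentBundle 𝓘(ℝ, F) G := fun _ => Bundle.TotalSpace.mk' F 1 v
  have sfv : ContMDiff 𝓘(ℝ, F) 𝓘(ℝ, F).tangent ∞ fv := contMDiff_const
  have S₁ := sfg.prodMk sfv
  let F₂ : (TangentBundle 𝓘(ℝ, F) G × TangentBundle 𝓘(ℝ, F) G) →
      TangentBundle (𝓘(ℝ, F).prod 𝓘(ℝ, F)) (G × G) :=
    (equivTangentBundleProd 𝓘(ℝ, F) G 𝓘(ℝ, F) G).symm
  have S₂ : ContMDiff _ _ ∞ F₂ := contMDiff_equivTangentBundleProd_symm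
  let F₃ : TangentBundle (𝓘(ℝ, F).prod 𝓘(ℝ, F)) (G × G) → TangentBundle 𝓘(ℝ, F) G :=
    tangentMap (𝓘(ℝ, F).prod 𝓘(ℝ, F)) 𝓘(ℝ, F) (fun p : G × G => p.1 * p.2)
  have S₃ : ContMDiff _ _ ∞ F₃ :=
    ContMDiff.contMDiff_tangentMap (n := ∞) (contMDiff_mul 𝓘(ℝ, F) ∞) le_rfl
  let S := (S₃.comp S₂).comp S₁
  convert! S with g
  · simp [F₂, F₃, fg, fv]
  · simp only [Function.comp_apply, tangentMap, F₃, F₂, fg, fv]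
    rw [mfderiv_prod_eq_add_apply ((contMDiff_mul 𝓘(ℝ, F) ∞).mdifferentiableAt (by simp))]
    exact ((congrArg (· + mfderiv 𝓘(ℝ, F) 𝓘(ℝ, F) (fun h : G => g * h) 1 v)
      (map_zero (mfderiv 𝓘(ℝ, F) 𝓘(ℝ, F) (fun h : G => h * 1) g))).trans (zero_add _)).symm

lemma mlieBracket_mulInvariantVectorField [CompleteSpace F] (v w : GroupLieAlgebra 𝓘(ℝ, F) G) :
    VectorField.mlieBracket 𝓘(ℝ, F) (mulInvariantVectorField v) (mulInvariantVectorField w) =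
      mulInvariantVectorField (G := G) ⁅v, w⁆ := by
  have : LieGroup 𝓘(ℝ, F) (minSmoothness ℝ 3) G := by
    rw [minSmoothness_of_isRCLikeNormedField]
    infer_instance
  exact (mulInvariantVector_mlieBracket v w).symm

/-- Conjugation is right translation by g⁻¹ after left translation by g. Thus the pushed-forward C
is R_{B⁻¹*} applied to L_{B*}(C) + Y(B). -/
lemma Ad_eq_rightPushInv_leftPush (g : G) (v : GroupLieAlgebra 𝓘(ℝ, F) G) :
    Ad g v = rightPushInv g (leftPush g v) := by
  have h1 : MDifferentiableAt 𝓘(ℝ, F) 𝓘(ℝ, F) (fun h : G => g * h) 1 :=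
    (contMDiff_mul_left (n := ∞)).mdifferentiableAt (by simp)
  have h2 : MDifferentiableAt 𝓘(ℝ, F) 𝓘(ℝ, F) (fun h : G => h * g⁻¹) (g * 1) :=
    (contMDiff_mul_right (n := ∞)).mdifferentiableAt (by simp)
  have h := DFunLike.congr_fun (mfderiv_comp (1 : G) h2 h1) v
  rw [mul_one] at h
  exact h

variable [FiniteDimensional ℝ F]

/-- As `F` is finite-dimensional, smoothness into `F →L[ℝ] F` can be tested on each vector, where it
is smoothness of a left invariant field in the chart. -/
lemma contDiffAt_invariantFrame {q : F} (hq : q ∈ (extChartAt 𝓘(ℝ, F) (1 : G)).target) :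
    ContDiffAt ℝ ∞ (invariantFrame F G) q := by
  have := FiniteDimensional.complete ℝ F
  refine ContDiffOn.contDiffAt (contDiffOn_clm_apply.2 fun v q hq => ?_)
    ((isOpen_extChartAt_target (1 : G)).mem_nhds hq)
  exact (contDiffAt_chartField hq (contMDiff_infty_mulInvariantVectorField _)).contDiffWithinAt

lemma lieBracket_invariantFrame {q : F} (hq : q ∈ (extChartAt 𝓘(ℝ, F) (1 : G)).target) (v w : F) :
    VectorField.lieBracket ℝ (fun q => invariantFrame F G q v) (fun q => invariantFrame F G q w) q =
      invariantFrame F G q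
        (modelBracket F G v w) := by
  have := FiniteDimensional.complete ℝ F
  have h := lieBracket_chartField hq
    (contMDiff_infty_mulInvariantVectorField (F := F) (G := G) v)
    (contMDiff_infty_mulInvariantVectorField (F := F) (G := G) w)
  exact h.trans (congrArg (fun Y => chartField (E := F) (1 : G) Y q)
    (mlieBracket_mulInvariantVectorField v w))

end LieGroup

/-! ### Solving the equations for B and η on the manifold -/

section Gauge

variable {E : Type*} [NormedAddCommGroup E] [NormedSpace ℝ E]
  {M : Type*} [TopologicalSpace M] [ChartedSpace E M]
  {F : Type*} [NormedAddCommGroup F] [NormedSpace ℝ F]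
  {G : Type*} [TopologicalSpace G] [ChartedSpace F G] [Group G]
  {r : ℕ} {V : Fin r → Triple E M F G}

lemma eventually_mem_extChartAt_target (x₀ : M) : ∀ᶠ p in 𝓝 (extChartAt 𝓘(ℝ, E) x₀ x₀),
    p ∈ (extChartAt 𝓘(ℝ, E) x₀).target :=
  (isOpen_extChartAt_target x₀).mem_nhds (mem_extChartAt_target x₀)

variable [IsManifold 𝓘(ℝ, E) ∞ M]

/-- A bracket in the real span is one linear combination of triples. So the fields, the Lie algebra
parts and the scalar parts share the same coefficients, constant over M. -/
lemma exists_structure_constants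
    (hK : IsLieAlgebra (Submodule.span ℝ (range V))) :
    ∃ c : Fin r → Fin r → Fin r → ℝ, ∀ i j,
      (∀ x, VectorField.mlieBracket 𝓘(ℝ, E) (V i).Y (V j).Y x = ∑ k, c i j k • (V k).Y x) ∧
      (∀ x, derivAlongLie (V i).Y (V j).C x - derivAlongLie (V j).Y (V i).C x -
        ⁅(V i).C x, (V j).C x⁆ = ∑ k, c i j k • (V k).C x) ∧
      ∀ x, derivAlong (V i).Y (V j).τ x - derivAlong (V j).Y (V i).τ x =
        ∑ k, c i j k • (V k).τ x := by
  have hmem : ∀ i j, ∃ c : Fin r → ℝ, ∑ k, c k • V k = bracket (V i) (V j) := fun i j =>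
    (Submodule.mem_span_range_iff_exists_fun ℝ).1 (hK.bracket_mem _ (Submodule.subset_span ⟨i, rfl⟩)
      _ (Submodule.subset_span ⟨j, rfl⟩))
  choose c hc using hmem
  refine ⟨c, fun i j => ⟨fun x => ?_, fun x => ?_, fun x => ?_⟩⟩
  · have := congrFun (congrArg Prod.fst (hc i j)) x
    rw [Prod.fst_sum, Finset.sum_apply] at this
    exact this.symm
  · have := congrFun (congrArg (fun T => T.2.1) (hc i j)) x
    simp only [Prod.snd_sum, Prod.fst_sum, Finset.sum_apply] at this
    exact this.symm
  · have := congrFun (congrArg (fun T => T.2.2) (hc i j)) x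
    simp only [Prod.snd_sum, Finset.sum_apply] at this
    exact this.symm

lemma isInfinitesimal_of_span (hK : IsLieAlgebra (Submodule.span ℝ (range V))) (i : Fin r) :
    IsInfinitesimal (V i) := hK.infinitesimal _ (Submodule.subset_span ⟨i, rfl⟩)

lemma linearIndependent_chartField (hreg : IsRegular fun i => (V i).Y) (x₀ : M) :
    LinearIndependent ℝ fun i =>
      chartField (E := E) x₀ (V i).Y (extChartAt 𝓘(ℝ, E) x₀ x₀) := by
  have hx := mem_extChartAt_source (I := 𝓘(ℝ, E)) x₀
  obtain ⟨e, he⟩ := isInvertible_mfderiv_extChartAt (I := 𝓘(ℝ, E)) hx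
  have h := (hreg x₀).map' (mfderiv 𝓘(ℝ, E) 𝓘(ℝ, E) (extChartAt 𝓘(ℝ, E) x₀) x₀).toLinearMap
    (by rw [← he]; exact e.toLinearEquiv.ker)
  have h2 : (fun i => chartField (E := E) x₀ (V i).Y (extChartAt 𝓘(ℝ, E) x₀ x₀)) =
      (mfderiv 𝓘(ℝ, E) 𝓘(ℝ, E) (extChartAt 𝓘(ℝ, E) x₀) x₀).toLinearMap ∘
        fun i => (V i).Y x₀ :=
    funext fun i => (mfderiv_extChartAt_eq_chartField hx (V i).Y).symm
  rw [h2]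
  exact h

lemma contDiffAt_comp_extChartAt_symm {W : Type*} [NormedAddCommGroup W] [NormedSpace ℝ W]
    {f : M → W} (hf : ContMDiff 𝓘(ℝ, E) 𝓘(ℝ, W) ∞ f) {x₀ : M} {p : E}
    (hp : p ∈ (extChartAt 𝓘(ℝ, E) x₀).target) :
    ContDiffAt ℝ ∞ (f ∘ (extChartAt 𝓘(ℝ, E) x₀).symm) p :=
  (hf.contMDiffAt.comp p (contMDiffAt_extChartAt_symm_of_mem hp)).contDiffAt

variable [FiniteDimensional ℝ E]

lemma lieBracket_chartField_eq_sum {c : Fin r → Fin r → Fin r → ℝ}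
    (hV : ∀ i, IsInfinitesimal (V i))
    (hc : ∀ i j x, VectorField.mlieBracket 𝓘(ℝ, E) (V i).Y (V j).Y x =
      ∑ k, c i j k • (V k).Y x) {x₀ : M} {p : E} (hp : p ∈ (extChartAt 𝓘(ℝ, E) x₀).target)
    (i j : Fin r) :
    VectorField.lieBracket ℝ (chartField (E := E) x₀ (V i).Y) (chartField (E := E) x₀ (V j).Y) p =
      ∑ k, c i j k • chartField (E := E) x₀ (V k).Y p := by
  have := FiniteDimensional.complete ℝ E
  rw [lieBracket_chartField hp (hV i).smooth_Y (hV j).smooth_Y]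
  have h := congrArg
    (mfderiv 𝓘(ℝ, E) 𝓘(ℝ, E) (extChartAt 𝓘(ℝ, E) x₀).symm p).inverse
    (hc i j ((extChartAt 𝓘(ℝ, E) x₀).symm p))
  rw [map_sum] at h
  simp only [map_smul] at h
  exact h

/-- The equation `Y i (u) = -Λ_u (C i)` for a vector-valued function on a chart domain. -/
lemma exists_parallel_chart {H W : Type*} [NormedAddCommGroup H] [NormedSpace ℝ H]
    [FiniteDimensional ℝ H] [NormedAddCommGroup W] [NormedSpace ℝ W]
    (hV : ∀ i, IsInfinitesimal (V i)) (hreg : IsRegular fun i => (V i).Y)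
    {c : Fin r → Fin r → Fin r → ℝ}
    (hc : ∀ i j x, VectorField.mlieBracket 𝓘(ℝ, E) (V i).Y (V j).Y x =
      ∑ k, c i j k • (V k).Y x)
    {C : Fin r → M → W} (hC : ∀ i, ContMDiff 𝓘(ℝ, E) 𝓘(ℝ, W) ∞ (C i))
    {Λ : H → W →L[ℝ] H} {br : W → W → W} (h₀ : H)
    (hΛ : ∀ᶠ h in 𝓝 h₀, ContDiffAt ℝ ∞ Λ h)
    (hΛbr : ∀ᶠ h in 𝓝 h₀, ∀ v w,
      VectorField.lieBracket ℝ (fun h => Λ h v) (fun h => Λ h w) h = Λ h (br v w))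
    (hflat : ∀ i j x, derivAlong (V i).Y (C j) x - derivAlong (V j).Y (C i) x -
      br (C i x) (C j x) = ∑ k, c i j k • C k x) (x₀ : M) :
    ∃ u : M → H, u x₀ = h₀ ∧ ∀ᶠ x in 𝓝 x₀, ContMDiffAt 𝓘(ℝ, E) 𝓘(ℝ, H) ∞ u x ∧
      ∀ i, derivAlong (V i).Y u x = -Λ (u x) (C i x) := by
  have := FiniteDimensional.complete ℝ E
  have ht := eventually_mem_extChartAt_target (E := E) x₀
  obtain ⟨u, hu0, hu⟩ := exists_parallel (Λ := Λ) (br := br)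
    (y := fun i => chartField (E := E) x₀ (V i).Y)
    (C := fun i => C i ∘ (extChartAt 𝓘(ℝ, E) x₀).symm)
    (x₀ := extChartAt 𝓘(ℝ, E) x₀ x₀) (h₀ := h₀) c
    (fun i => ht.mono fun p hp => contDiffAt_chartField hp (hV i).smooth_Y)
    (fun i => ht.mono fun p hp => contDiffAt_comp_extChartAt_symm (hC i) hp) hΛ
    (linearIndependent_chartField hreg x₀)
    (fun i j => ht.mono fun p hp => lieBracket_chartField_eq_sum hV hc hp i j) hΛbr
    (fun i j => ht.mono fun p hp => by
      rw [fderiv_comp_symm_chartField hp ((hC j).mdifferentiableAt (by simp)),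
        fderiv_comp_symm_chartField hp ((hC i).mdifferentiableAt (by simp))]
      exact hflat i j _)
  refine ⟨u ∘ extChartAt 𝓘(ℝ, E) x₀, hu0, ?_⟩
  filter_upwards [(continuousAt_extChartAt (I := 𝓘(ℝ, E)) x₀).eventually hu,
    extChartAt_source_mem_nhds (I := 𝓘(ℝ, E)) x₀] with x ⟨hx1, hx2⟩ hx
  have hex : ContMDiffAt 𝓘(ℝ, E) 𝓘(ℝ, E) ∞ (extChartAt 𝓘(ℝ, E) x₀) x :=
    contMDiffAt_extChartAt' (by simpa using hx)
  refine ⟨hx1.contMDiffAt.comp x hex, fun i => ?_⟩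
  have h1 := mfderiv_comp x (hx1.contMDiffAt.mdifferentiableAt (by simp))
    (hex.mdifferentiableAt (by simp))
  rw [mfderiv_eq_fderiv] at h1
  have h2 := hx2 i
  simp only [Function.comp_apply, (extChartAt 𝓘(ℝ, E) x₀).left_inv hx] at h2
  exact ((DFunLike.congr_fun h1 ((V i).Y x)).trans (congrArg (fderiv ℝ u (extChartAt 𝓘(ℝ, E) x₀ x))
    (mfderiv_extChartAt_eq_chartField hx (V i).Y))).trans h2

/-- The equation is solved for the chart expression of B, with `invariantFrame` as Λ and initial
value the chart image of 1; by continuity the solution stays in the chart target near x₀ and can be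
lifted to `G`. -/
theorem exists_groupGauge [FiniteDimensional ℝ F] [LieGroup 𝓘(ℝ, F) ∞ G]
    (hK : IsLieAlgebra (Submodule.span ℝ (range V))) (hreg : IsRegular fun i => (V i).Y) (x₀ : M) :
    ∃ B : M → G, ∀ᶠ x in 𝓝 x₀, ContMDiffAt 𝓘(ℝ, E) 𝓘(ℝ, F) ∞ B x ∧
      ∀ i, pushAlong (V i).Y B x = -leftPush (B x) ((V i).C x) := by
  obtain ⟨c, hc⟩ := exists_structure_constants hK
  have hV := isInfinitesimal_of_span hK
  have ht := eventually_mem_extChartAt_target (E := F) (1 : G)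
  obtain ⟨u, hu0, hu⟩ := exists_parallel_chart hV hreg (fun i j => (hc i j).1)
    (C := fun i => toModel (V i).C) (fun i => (hV i).smooth_C) (Λ := invariantFrame F G)
    (br := modelBracket F G) (extChartAt 𝓘(ℝ, F) (1 : G) 1)
    (ht.mono fun q hq => contDiffAt_invariantFrame hq)
    (ht.mono fun q hq v w => lieBracket_invariantFrame hq v w)
    (fun i j => (hc i j).2.1) x₀
  have hut : Tendsto u (𝓝 x₀) (𝓝 (extChartAt 𝓘(ℝ, F) (1 : G) 1)) :=
    hu0 ▸ hu.self_of_nhds.1.continuousAt.tendsto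
  refine ⟨(extChartAt 𝓘(ℝ, F) (1 : G)).symm ∘ u, ?_⟩
  filter_upwards [hu, hut.eventually ht] with x ⟨hx1, hx2⟩ hxt
  have hs := contMDiffAt_extChartAt_symm_of_mem hxt
  refine ⟨hs.comp x hx1, fun i => ?_⟩
  have h1 := mfderiv_comp x (hs.mdifferentiableAt (by simp)) (hx1.mdifferentiableAt (by simp))
  have h2 := mfderiv_symm_chartField hxt
    (mulInvariantVectorField (G := G) (I := 𝓘(ℝ, F)) ((V i).C x))
  have h3 := (DFunLike.congr_fun h1 ((V i).Y x)).trans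
    (congrArg (mfderiv 𝓘(ℝ, F) 𝓘(ℝ, F) (extChartAt 𝓘(ℝ, F) (1 : G)).symm (u x)) (hx2 i))
  have h4 := h3.trans (map_neg (mfderiv 𝓘(ℝ, F) 𝓘(ℝ, F) (extChartAt 𝓘(ℝ, F) (1 : G)).symm (u x)) _)
  exact h4.trans (congrArg Neg.neg h2)

/-- The abelian case: Y_i(f) = -τ_i is solved with constant frame and zero bracket, and η = exp f is
positive everywhere, not only near x₀. -/
theorem exists_scalarGauge (hK : IsLieAlgebra (Submodule.span ℝ (range V)))
    (hreg : IsRegular fun i => (V i).Y) (x₀ : M) :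
    ∃ η : M → ℝ, (∀ x, 0 < η x) ∧ ∀ᶠ x in 𝓝 x₀, ContMDiffAt 𝓘(ℝ, E) 𝓘(ℝ, ℝ) ∞ η x ∧
      ∀ i, derivAlong (V i).Y η x = -(V i).τ x * η x := by
  obtain ⟨c, hc⟩ := exists_structure_constants hK
  have hV := isInfinitesimal_of_span hK
  obtain ⟨f, -, hf⟩ := exists_parallel_chart hV hreg (fun i j => (hc i j).1)
    (C := fun i => (V i).τ) (fun i => (hV i).smooth_τ)
    (Λ := fun _ : ℝ => ContinuousLinearMap.id ℝ ℝ) (br := fun _ _ => 0) 0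
    (Eventually.of_forall fun _ => contDiffAt_const)
    (Eventually.of_forall fun _ v w => by simp [VectorField.lieBracket])
    (fun i j x => by rw [sub_zero]; exact (hc i j).2.2 x) x₀
  refine ⟨fun x => Real.exp (f x), fun x => Real.exp_pos _, ?_⟩
  filter_upwards [hf] with x ⟨hx1, hx2⟩
  have he : ContMDiffAt 𝓘(ℝ, ℝ) 𝓘(ℝ, ℝ) ∞ Real.exp (f x) := Real.contDiff_exp.contDiffAt.contMDiffAt
  refine ⟨he.comp x hx1, fun i => ?_⟩
  have h1 := mfderiv_comp x (he.mdifferentiableAt (by simp)) (hx1.mdifferentiableAt (by simp))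
  rw [mfderiv_eq_fderiv] at h1
  have h2 := (DFunLike.congr_fun h1 ((V i).Y x)).trans
    (congrArg (fderiv ℝ Real.exp (f x)) (hx2 i))
  refine h2.trans ?_
  change fderiv ℝ Real.exp (f x) (-(V i).τ x) = _
  rw [(Real.hasDerivAt_exp (f x)).hasFDerivAt.fderiv]
  simp

end Gauge

end StochSym

namespace StochSym

open Set Filter Topology

/-! ### Restriction to an open subset -/

section Restriction

variable {E : Type*} [NormedAddCommGroup E] [NormedSpace ℝ E]
  {M : Type*} [TopologicalSpace M] [ChartedSpace E M]

/-- The inclusion has a local inverse `ρ`, so the chain rule makes the two differentials mutually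
inverse. -/
lemma isInvertible_mfderiv_subtype_val {U : TopologicalSpace.Opens M} (x : U) :
    (mfderiv 𝓘(ℝ, E) 𝓘(ℝ, E) (Subtype.val : U → M) x).IsInvertible := by
  classical
  -- The value off `U` is arbitrary; only the germ of `ρ` at `x` matters.
  let ρ : M → U := fun y => if h : y ∈ U then ⟨y, h⟩ else x
  have hρ : ∀ y : U, ρ y = y := fun y => by simp [ρ]
  have hρs : MDifferentiableAt 𝓘(ℝ, E) 𝓘(ℝ, E) ρ x := by
    have : ContMDiffAt 𝓘(ℝ, E) 𝓘(ℝ, E) ∞ (fun y : U => ρ y) x := by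
      simp only [hρ]
      exact contMDiffAt_id
    exact (contMDiffAt_subtype_iff.1 this).mdifferentiableAt (by simp)
  have hv : ∀ y : U, MDifferentiableAt 𝓘(ℝ, E) 𝓘(ℝ, E) (Subtype.val : U → M) y := fun y =>
    (contMDiff_subtype_val (n := ∞)).mdifferentiableAt (by simp)
  have h1 := mfderiv_comp x hρs (hv x)
  have e1 : ρ ∘ (Subtype.val : U → M) = id := funext hρ
  rw [e1, mfderiv_id] at h1
  have h2 := mfderiv_comp (x : M) (hv (ρ x)) hρs
  have e2 : (Subtype.val : U → M) ∘ ρ =ᶠ[𝓝 (x : M)] id := by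
    filter_upwards [U.isOpen.mem_nhds x.2] with y hy
    exact congrArg Subtype.val (hρ ⟨y, hy⟩)
  rw [e2.mfderiv_eq, mfderiv_id, hρ] at h2
  exact ContinuousLinearMap.IsInvertible.of_inverse h2.symm h1.symm

lemma mfderiv_comp_subtype_val {E' : Type*} [NormedAddCommGroup E'] [NormedSpace ℝ E']
    {N : Type*} [TopologicalSpace N] [ChartedSpace E' N] {U : TopologicalSpace.Opens M} {f : M → N}
    {x : U} (hf : MDifferentiableAt 𝓘(ℝ, E) 𝓘(ℝ, E') f x)
    (Y : (x : M) → TangentSpace 𝓘(ℝ, E) x) :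
    mfderiv 𝓘(ℝ, E) 𝓘(ℝ, E') (fun y : U => f y) x
      (VectorField.mpullback 𝓘(ℝ, E) 𝓘(ℝ, E) (Subtype.val : U → M) Y x) =
      mfderiv 𝓘(ℝ, E) 𝓘(ℝ, E') f x (Y x) := by
  have h1 := mfderiv_comp x hf
    ((contMDiff_subtype_val (n := ∞) : ContMDiff 𝓘(ℝ, E) 𝓘(ℝ, E) ∞
      (Subtype.val : U → M)).mdifferentiableAt (by simp))
  have h2 : mfderiv 𝓘(ℝ, E) 𝓘(ℝ, E) (Subtype.val : U → M) x
      (VectorField.mpullback 𝓘(ℝ, E) 𝓘(ℝ, E) (Subtype.val : U → M) Y x) = Y x := by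
    obtain ⟨e, he⟩ := isInvertible_mfderiv_subtype_val (E := E) x
    rw [VectorField.mpullback_apply, ← he, ContinuousLinearMap.inverse_equiv]
    exact e.apply_symm_apply _
  exact (DFunLike.congr_fun h1 _).trans (congrArg (mfderiv 𝓘(ℝ, E) 𝓘(ℝ, E') f x) h2)

end Restriction

end StochSym

/-! ### Assembly of the theorem -/

open StochSym

theorem mainTheorem6
    {E : Type*} [NormedAddCommGroup E] [NormedSpace ℝ E] [FiniteDimensional ℝ E]
    {M : Type*} [TopologicalSpace M] [ChartedSpace E M] [IsManifold 𝓘(ℝ, E) ∞ M]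
    {F : Type*} [NormedAddCommGroup F] [NormedSpace ℝ F] [FiniteDimensional ℝ F]
    {G : Type*} [TopologicalSpace G] [ChartedSpace F G] [Group G] [LieGroup 𝓘(ℝ, F) ∞ G]
    {r : ℕ} (V : Fin r → StochSym.Triple E M F G)
    (hK : StochSym.IsLieAlgebra (Submodule.span ℝ (Set.range V)))
    (hreg : StochSym.IsRegular (fun i => (V i).Y))
    (x₀ : M) :
    ∃ U : TopologicalSpace.Opens M, x₀ ∈ U ∧
      ∃ T : StochSym.StochTransf E U E U F G,
        T.Φ = Diffeomorph.refl 𝓘(ℝ, E) U ∞ ∧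
        (∀ i, StochSym.IsInfinitesimal (T.pushforward ((V i).restrict U)) ∧
          StochSym.IsStrong (T.pushforward ((V i).restrict U)) ∧
          (T.pushforward ((V i).restrict U)).Y = ((V i).restrict U).Y) ∧
        (∀ i, ∀ x : U,
          StochSym.pushAlong ((V i).restrict U).Y T.B x
            = -StochSym.leftPush (T.B x) (((V i).restrict U).C x)) ∧
        (∀ i, ∀ x : U,
          StochSym.derivAlong ((V i).restrict U).Y T.η x
            = -(((V i).restrict U).τ x) * T.η x) := by
  have := FiniteDimensional.complete ℝ E
  obtain ⟨B, hB⟩ := exists_groupGauge hK hreg x₀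
  obtain ⟨η, hη0, hη⟩ := exists_scalarGauge hK hreg x₀
  obtain ⟨U, hU, hUo, hxU⟩ := mem_nhds_iff.1 (hB.and hη)
  let U' : TopologicalSpace.Opens M := ⟨U, hUo⟩
  have hU' : ∀ x : U', _ := fun x => hU x.2
  let T : StochTransf E U' E U' F G :=
    { Φ := Diffeomorph.refl 𝓘(ℝ, E) U' ∞
      B := fun x => B x
      η := fun x => η x
      smooth_B := fun x => contMDiffAt_subtype_iff.2 (hU' x).1.1
      smooth_η := fun x => contMDiffAt_subtype_iff.2 (hU' x).2.1
      η_pos := fun x => hη0 x }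
  have hTB : ∀ i, ∀ x : U', pushAlong ((V i).restrict U').Y T.B x
      = -leftPush (T.B x) (((V i).restrict U').C x) := fun i x =>
    (mfderiv_comp_subtype_val ((hU' x).1.1.mdifferentiableAt (by simp)) (V i).Y).trans
      ((hU' x).1.2 i)
  have hTη : ∀ i, ∀ x : U', derivAlong ((V i).restrict U').Y T.η x
      = -(((V i).restrict U').τ x) * T.η x := fun i x =>
    (mfderiv_comp_subtype_val ((hU' x).2.1.mdifferentiableAt (by simp)) (V i).Y).trans
      ((hU' x).2.2 i)
  have hY : ∀ i, (T.pushforward ((V i).restrict U')).Y = ((V i).restrict U').Y := fun i => by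
    funext x
    have : mfderiv 𝓘(ℝ, E) 𝓘(ℝ, E) (id : U' → U') x = ContinuousLinearMap.id ℝ _ := mfderiv_id
    exact DFunLike.congr_fun this (((V i).restrict U').Y x)
  have hC : ∀ i, (T.pushforward ((V i).restrict U')).C = 0 := fun i => by
    funext x
    change Ad (T.B x) (((V i).restrict U').C x) +
      rightPushInv (T.B x) (pushAlong ((V i).restrict U').Y T.B x) = 0
    -- The sum becomes R_{B⁻¹*}(L_{B*}(C)) + R_{B⁻¹*}(-L_{B*}(C)), which vanishes by linearity.
    rw [hTB, Ad_eq_rightPushInv_leftPush]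
    have := map_neg (mfderiv 𝓘(ℝ, F) 𝓘(ℝ, F) (fun h : G => h * (T.B x)⁻¹) (T.B x))
      (leftPush (T.B x) (((V i).restrict U').C x))
    exact (congrArg (rightPushInv (T.B x) (leftPush (T.B x) (((V i).restrict U').C x)) + ·)
      this).trans (add_neg_cancel _)
  have hτ : ∀ i, (T.pushforward ((V i).restrict U')).τ = 0 := fun i => by
    funext x
    change ((V i).restrict U').τ x + derivAlong ((V i).restrict U').Y T.η x * (T.η x)⁻¹ = 0
    rw [hTη, mul_assoc, mul_inv_cancel₀ (T.η_pos x).ne']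
    ring
  refine ⟨U', hxU, T, rfl, fun i => ⟨⟨?_, ?_, ?_⟩, ⟨hC i, hτ i⟩, hY i⟩, hTB, hTη⟩
  · rw [hY]
    exact ContMDiff.mpullback_vectorField (n := ∞)
      (isInfinitesimal_of_span hK i).smooth_Y contMDiff_subtype_val
      (fun x => isInvertible_mfderiv_subtype_val x) le_rfl
  · rw [hC]
    exact contMDiff_const
  · rw [hτ]
    exact contMDiff_const
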